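/- Consider an $s$-stage Runge–Kutta method ($s\ge 1$) with real coefficient matrix $\mathbf A\in\mathbb R^{s\times s}$ and weights $\mathbf b\in\mathbb R^s$. Put $\mathbb 1=(1,\dots,1)^T$ and $$\mathbf q(z)=\mathbf b^T(\mathbf I-z\mathbf A)^{-1},\qquad r(z)=1+z\,\mathbf b^T(\mathbf I-z\mathbf A)^{-1}\mathbb 1 .$$ Assume that the method - has classical order at least one, i.e. $\sum_i b_i=1$; - is A-stable: $\mathbf I-z\mathbf A$ is nonsingular and $|r(z)|\le 1$ for all $\Re z\le 0$; - satisfies $|r(\mathrm i y)|<1$ for all real $y\neq 0$; - has an invertible matrix $\mathbf A$; - is stiffly accurate: $\mathbf b^T\mathbf A^{-1}=(0,\dots,0,1)$. Let $h>0$, $x\in\mathbb R$, $d=|x|$. For $z\in\mathbb C\setminus(-\infty,0]$ and $\lambda>0$ let $$K(z,x)=\frac{1}{2\sqrt{z/\mathrm i}}\,e^{-d\sqrt{z/\mathrm i}},\qquad \sqrt{z/\mathrm i}:=e^{-\mathrm i\pi/4}\sqrt z \ \text{(principal branch)},\qquad G(\lambda,x)=\frac{\mathrm i e^{\mathrm i\pi/4}}{\sqrt\lambda}\cosh\!\big(d\,e^{\mathrm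 i\pi/4}\sqrt\lambda\big);$$ $G(\lambda,x)=K(\lambda e^{-\mathrm i\pi},x)-K(\lambda e^{\mathrm i\pi},x)$ is the jump of $K$ across the negative real axis. With $\boldsymbol\Delta(\zeta)=\big(\mathbf A+\frac{\zeta}{1-\zeta}\mathbb 1\mathbf b^T\big)^{-1}$, define $\mathbf W_n$ and $\mathbf E_n(z)$ by the expansions at $\zeta=0$ $$\sum_{n\ge0}\mathbf W_n\zeta^n=K\!\Big(\frac{\boldsymbol\Delta(\zeta)}{h},x\Big)\ \text{(matrix function)},\qquad \sum_{n\ge0}\mathbf E_n(z)\zeta^n=(\boldsymbol\Delta(\zeta)-z\mathbf I)^{-1},$$ let $\boldsymbol\omega_n(x)$ and $\mathbf e_n(z)$ be the last rows of $\mathbf W_n$ and $\mathbf E_n(z)$, and for $\xi>0$ let $$\mathbf I_n=\frac{h}{2\pi\mathrm i}\int_0^{\xi}G(\lambda,x)\,\mathbf e_n(-h\lambda)\,d\lambda,\qquad \gamma(\xi)=\inf_{-\xi\le\Re z<0,\ r(z)\ne0}\frac{\log|r(z)|}{\Re z}.$$ Fix any norm (or seminorm) $\|\cdot\|$ on row vectors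 in $\mathbb C^s$, and let $\xi>1$. Then $\gamma(h\xi)>0$, and there is a constant $C_A>0$ with $$\max\big(|r(z)|,\|\mathbf q(z)\|\big)\le C_A|z|^{-1}\qquad\text{for all } z\ne0,\ \Re z\le 0. \tag{$*$}$$ For every constant $C_A>0$ satisfying $(*)$, every $\varepsilon>0$ and every integer $n\ge0$, $$\|\boldsymbol\omega_n(x)-\mathbf I_n\|\le\varepsilon\quad\text{if}\quad n\ge\frac{1}{h\xi\gamma(h\xi)}\left(d\sqrt{\xi/2}+\log\frac{C_A\sqrt{2\pi}}{4\sqrt{\xi}\,\Gamma(3/4)^2\,\varepsilon}\right).$$ -/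

import Mathlib

noncomputable section

namespace RKCQ

/-- The coefficients of a Runge-Kutta method with `m + 1` stages (the abscissae of the Butcher
tableau play no role for the convolution weights). -/
structure RungeKutta (m : ℕ) where
  A : Matrix (Fin (m + 1)) (Fin (m + 1)) ℝ
  b : Fin (m + 1) → ℝ

/-- The `n`-th coefficient of the power series expansion at `0` of a matrix-valued function. -/
def powerCoeff {ι : Type*} (F : ℂ → Matrix ι ι ℂ) (n : ℕ) : Matrix ι ι ℂ :=
  Matrix.of fun i j => iteratedDeriv n (fun ζ => F ζ i j) 0 / (n.factorial : ℂ)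

/-- `F` is the value `f(M)` of the scalar function `f` at the square matrix `M`: it equals `p(M)` for
a polynomial `p` that agrees with `f` at every eigenvalue of `M`, together with the derivatives of
order less than the algebraic multiplicity of that eigenvalue. -/
def IsMatrixFunction {ι : Type*} [Fintype ι] [DecidableEq ι]
    (f : ℂ → ℂ) (M F : Matrix ι ι ℂ) : Prop :=
  ∃ p : Polynomial ℂ, F = Polynomial.aeval M p ∧
    ∀ (μ : ℂ) (k : ℕ), k < M.charpoly.rootMultiplicity μ →
      (Polynomial.derivative^[k] p).eval μ = iteratedDeriv k f μ

/-- The matrix `f(M)`; a matrix as in `IsMatrixFunction` exists and is unique by Hermite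
interpolation. -/
def matrixFunction {ι : Type*} [Fintype ι] [DecidableEq ι]
    (f : ℂ → ℂ) (M : Matrix ι ι ℂ) : Matrix ι ι ℂ :=
  Classical.epsilon (IsMatrixFunction f M)

/-- `√(z/i) = e^{-iπ/4} √z`, with the principal branch of the square root. -/
def sqrtDivI (z : ℂ) : ℂ :=
  Complex.exp (-(Complex.I * Real.pi / 4)) * z ^ (1 / 2 : ℂ)

/-- The transfer operator of the one-dimensional Schroedinger equation. -/
def transferK (x : ℝ) (z : ℂ) : ℂ :=
  1 / (2 * sqrtDivI z) * Complex.exp (-((|x| : ℝ) : ℂ) * sqrtDivI z)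

/-- The jump of the transfer operator across the negative real axis,
`G(l, x) = K(l e^{-iπ}, x) - K(l e^{iπ}, x)`, in its explicit form. -/
def jumpG (l x : ℝ) : ℂ :=
  Complex.I * Complex.exp (Complex.I * Real.pi / 4) / ((Real.sqrt l : ℝ) : ℂ) *
    Complex.cosh (((|x| : ℝ) : ℂ) * Complex.exp (Complex.I * Real.pi / 4) *
      ((Real.sqrt l : ℝ) : ℂ))

namespace RungeKutta

variable {m : ℕ} (M : RungeKutta m)

/-- The coefficient matrix with complex entries. -/
def Ac : Matrix (Fin (m + 1)) (Fin (m + 1)) ℂ := M.A.map (fun a => (a : ℂ))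

/-- The weight vector with complex entries. -/
def bc : Fin (m + 1) → ℂ := fun i => (M.b i : ℂ)

/-- The row vector `q(z) = bᵀ (I - z A)⁻¹`. -/
def q (z : ℂ) : Fin (m + 1) → ℂ := Matrix.vecMul M.bc (1 - z • M.Ac)⁻¹

/-- The stability function `r(z) = 1 + z bᵀ (I - z A)⁻¹ 𝟙`. -/
def r (z : ℂ) : ℂ := 1 + z * (M.bc ⬝ᵥ Matrix.mulVec (1 - z • M.Ac)⁻¹ 1)

/-- The assumptions on the Runge-Kutta method. -/
structure Admissible : Prop where
  /-- The classical order is at least one (consistency). -/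
  order_one : ∑ i, M.b i = 1
  /-- A-stability: `I - z A` is nonsingular in the closed left half-plane, ... -/
  nonsingular : ∀ z : ℂ, z.re ≤ 0 → IsUnit (1 - z • M.Ac)
  /-- ... and the stability function is bounded by one there. -/
  stable : ∀ z : ℂ, z.re ≤ 0 → ‖M.r z‖ ≤ 1
  strict_on_axis : ∀ y : ℝ, y ≠ 0 → ‖M.r (Complex.I * y)‖ < 1
  invertible : IsUnit M.A
  /-- Stiff accuracy: `bᵀ A⁻¹ = (0, …, 0, 1)`. -/
  stiffly_accurate : Matrix.vecMul M.b M.A⁻¹ = Pi.single (Fin.last m) 1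

/-- The symbol `Δ(ζ) = (A + ζ / (1 - ζ) 𝟙 bᵀ)⁻¹`. -/
def symbol (ζ : ℂ) : Matrix (Fin (m + 1)) (Fin (m + 1)) ℂ :=
  (M.Ac + (ζ / (1 - ζ)) • Matrix.vecMulVec 1 M.bc)⁻¹

/-- The convolution quadrature weight matrices `W_n`: `∑ W_n ζ^n = K(Δ(ζ) / h, x)`. -/
def weightMatrix (h x : ℝ) (n : ℕ) : Matrix (Fin (m + 1)) (Fin (m + 1)) ℂ :=
  powerCoeff (fun ζ => matrixFunction (transferK x) ((h : ℂ)⁻¹ • M.symbol ζ)) n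

/-- The weights `ω_n(x)`, the last row of `W_n`. -/
def omega (h x : ℝ) (n : ℕ) : Fin (m + 1) → ℂ := M.weightMatrix h x n (Fin.last m)

/-- The matrices `E_n(z)`: `∑ E_n(z) ζ^n = (Δ(ζ) - z I)⁻¹`. -/
def resolventMatrix (n : ℕ) (z : ℂ) : Matrix (Fin (m + 1)) (Fin (m + 1)) ℂ :=
  powerCoeff (fun ζ => (M.symbol ζ - z • (1 : Matrix (Fin (m + 1)) (Fin (m + 1)) ℂ))⁻¹) n

/-- The row vector `e_n(z)`, the last row of `E_n(z)`. -/
def e (n : ℕ) (z : ℂ) : Fin (m + 1) → ℂ := M.resolventMatrix n z (Fin.last m)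

/-- The truncated integral `I_n = h / (2πi) ∫_0^ξ G(l, x) e_n(-h l) dl`. -/
def truncatedIntegral (h x ξ : ℝ) (n : ℕ) : Fin (m + 1) → ℂ :=
  ((h : ℂ) / (2 * Real.pi * Complex.I)) •
    ∫ l in (0 : ℝ)..ξ, jumpG l x • M.e n (-((h * l : ℝ) : ℂ))

/-- `γ(ξ)`, the infimum of `log |r(z)| / Re z` over the strip `-ξ ≤ Re z ≤ 0`. The points where the
quotient is not a real number (`Re z = 0` or `r(z) = 0`) are left out; it is `+∞` at those with
`r(z) = 0`, and on the imaginary axis only limits from inside the strip make sense. -/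
def gamma (ξ : ℝ) : ℝ :=
  sInf {t : ℝ | ∃ z : ℂ, -ξ ≤ z.re ∧ z.re < 0 ∧ M.r z ≠ 0 ∧ t = Real.log ‖M.r z‖ / z.re}

/-- `C` can serve as the constant `C_A`, for the vector norm `N`:
`max (|r(z)|, N (q(z))) ≤ C |z|⁻¹` for `Re z ≤ 0`. -/
def IsDecayConstant (N : Seminorm ℂ (Fin (m + 1) → ℂ)) (C : ℝ) : Prop :=
  0 < C ∧ ∀ z : ℂ, z.re ≤ 0 → z ≠ 0 → max ‖M.r z‖ (N (M.q z)) ≤ C * ‖z‖⁻¹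

end RungeKutta

end RKCQ

end

/-! Stiff accuracy makes the last row of $(\Delta(\zeta)-z)^{-1}$ equal to $q(z)/(1-\zeta r(z))$, by
Sherman–Morrison (`symbol_sub_inv_last`). Hence $e_n(z)=r(z)^n q(z)$ for $\Re z\le 0$ (`e_eq`).

By A-stability the spectrum of $\Delta(\zeta)/h$ lies in the open right half-plane for $|\zeta|<1$.
A Cauchy formula along the imaginary axis (`matrixFunction_apply_eq_integral`) and a geometric
series then give $\omega_n=\frac{h}{2\pi}\int K(iy)\,r(ihy)^n q(ihy)\,dy$ (`omega_apply`). Moving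
this line to $\Re z=-\xi$ sweeps over the part $(-\xi,0)$ of the cut of $K$, whose two sides
contribute exactly $I_n$ (`integral_shift`). So $\omega_n-I_n$ is the same integral taken over $\Re
z=-\xi$ (`omega_sub_truncatedIntegral_apply`).

On that line $|K|\le \frac12 e^{d\sqrt{\xi/2}}|z|^{-1/2}$, $\|q(hz)\|\le C_A/(h|z|)$ and $|r(hz)|\le
e^{-h\xi\gamma(h\xi)}$. The integral of $|z|^{-3/2}$ is explicit and produces $\Gamma(3/4)^2$
(`integral_sq_add_sq_rpow`). The resulting bound (`seminorm_omega_sub_le`) is at most $\varepsilon$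
exactly under the stated condition on $n$. Positivity of $\gamma$ comes from Hadamard's three lines
theorem, since $|r|$ is bounded away from $1$ on vertical lines in the open left half-plane. -/

noncomputable section

open Complex Matrix Filter Topology MeasureTheory Set

namespace RKCQ

/-! ### Inverses of matrices depending holomorphically on a parameter. -/

section MatrixInverse

variable {n : Type*} [Fintype n] [DecidableEq n]

theorem differentiableAt_det {X : ℂ → Matrix n n ℂ} {z : ℂ}
    (hX : ∀ i j, DifferentiableAt ℂ (fun w => X w i j) z) :
    DifferentiableAt ℂ (fun w => (X w).det) z := by
  simp only [Matrix.det_apply]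
  refine DifferentiableAt.fun_sum fun σ _ => ?_
  refine DifferentiableAt.const_smul ?_ _
  exact DifferentiableAt.fun_finsetProd fun i _ => hX _ _

theorem differentiableAt_adjugate {X : ℂ → Matrix n n ℂ} {z : ℂ}
    (hX : ∀ i j, DifferentiableAt ℂ (fun w => X w i j) z) (i j : n) :
    DifferentiableAt ℂ (fun w => (X w).adjugate i j) z := by
  simp only [Matrix.adjugate_apply]
  refine differentiableAt_det fun k l => ?_
  by_cases hk : k = j
  · subst hk; simp
  · simpa [Matrix.updateRow_apply, hk] using hX k l

theorem differentiableAt_inv_entry {X : ℂ → Matrix n n ℂ} {z : ℂ}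
    (hX : ∀ i j, DifferentiableAt ℂ (fun w => X w i j) z) (hz : IsUnit (X z)) (i j : n) :
    DifferentiableAt ℂ (fun w => (X w)⁻¹ i j) z := by
  simp only [Matrix.inv_def, Ring.inverse_eq_inv', Matrix.smul_apply, smul_eq_mul]
  refine DifferentiableAt.mul (DifferentiableAt.inv (differentiableAt_det hX) ?_)
    (differentiableAt_adjugate hX i j)
  exact ((Matrix.isUnit_iff_isUnit_det _).1 hz).ne_zero

theorem isUnit_smul_one_sub_iff (B : Matrix n n ℂ) {z : ℂ} (hz : z ≠ 0) :
    IsUnit (z • (1 : Matrix n n ℂ) - B) ↔ IsUnit (1 - z⁻¹ • B) := by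
  have : z • (1 : Matrix n n ℂ) - B = (Units.mk0 z hz) • (1 - z⁻¹ • B) := by
    simp [Units.smul_def, smul_sub, smul_smul, hz]
  rw [this, isUnit_smul_iff]

theorem inv_smul_one_sub (B : Matrix n n ℂ) {z : ℂ} (hz : z ≠ 0) (h : IsUnit (1 - z⁻¹ • B)) :
    (z • (1 : Matrix n n ℂ) - B)⁻¹ = z⁻¹ • (1 - z⁻¹ • B)⁻¹ := by
  have : z • (1 : Matrix n n ℂ) - B = (Units.mk0 z hz) • (1 - z⁻¹ • B) := by
    simp [Units.smul_def, smul_sub, smul_smul, hz]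
  rw [this, Matrix.inv_smul' _ _ ((Matrix.isUnit_iff_isUnit_det _).1 h)]
  simp [Units.smul_def]

/-- The resolvent of a matrix is `O(1 / |z|)` at infinity. -/
theorem exists_resolvent_bound (B : Matrix n n ℂ) :
    ∃ R C : ℝ, 0 < R ∧ 0 < C ∧ ∀ z : ℂ, R ≤ ‖z‖ → IsUnit (z • (1 : Matrix n n ℂ) - B) ∧
      ∀ i j, ‖(z • (1 : Matrix n n ℂ) - B)⁻¹ i j‖ ≤ C * ‖z‖⁻¹ := by
  have hd : ∀ (z : ℂ) (i j : n), DifferentiableAt ℂ (fun w : ℂ => (1 - w • B) i j) z := by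
    intro z i j
    simp only [Matrix.sub_apply, Matrix.smul_apply, smul_eq_mul]
    fun_prop
  have hu0 : IsUnit (1 - (0 : ℂ) • B) := by simp
  have h1 : ∀ᶠ w in 𝓝 (0 : ℂ), IsUnit (1 - w • B) := by
    have := (differentiableAt_det (hd 0)).continuousAt.eventually_ne
      ((Matrix.isUnit_iff_isUnit_det _).1 hu0).ne_zero
    filter_upwards [this] with w hw
    exact (Matrix.isUnit_iff_isUnit_det _).2 (isUnit_iff_ne_zero.2 hw)
  have h2 : ∀ i j, ∀ᶠ w in 𝓝 (0 : ℂ), ‖(1 - w • B)⁻¹ i j‖ < ‖(1 - (0 : ℂ) • B)⁻¹ i j‖ + 1 :=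
    fun i j => (differentiableAt_inv_entry (hd 0) hu0 i j).continuousAt.norm.eventually_lt_const
      (by simp)
  have h3 : ∀ᶠ w in 𝓝 (0 : ℂ), IsUnit (1 - w • B) ∧ ∀ i j,
      ‖(1 - w • B)⁻¹ i j‖ < ‖(1 - (0 : ℂ) • B)⁻¹ i j‖ + 1 :=
    h1.and (eventually_all.2 fun i => eventually_all.2 fun j => h2 i j)
  obtain ⟨δ, hδ, h4⟩ := Metric.eventually_nhds_iff.1 h3
  have hs : ∀ i j, ‖(1 - (0 : ℂ) • B)⁻¹ i j‖ ≤ ∑ k, ∑ l, ‖(1 - (0 : ℂ) • B)⁻¹ k l‖ := fun i j =>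
    (Finset.single_le_sum (f := fun l => ‖(1 - (0 : ℂ) • B)⁻¹ i l‖)
      (fun _ _ => norm_nonneg _) (Finset.mem_univ j)).trans
    (Finset.single_le_sum (f := fun k => ∑ l, ‖(1 - (0 : ℂ) • B)⁻¹ k l‖)
      (fun _ _ => Finset.sum_nonneg fun _ _ => norm_nonneg _) (Finset.mem_univ i))
  refine ⟨2 / δ, ∑ k, ∑ l, ‖(1 - (0 : ℂ) • B)⁻¹ k l‖ + 1, by positivity, by positivity,
    fun z hz => ?_⟩
  have hzp : 0 < ‖z‖ := lt_of_lt_of_le (by positivity) hz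
  have hz0 : z ≠ 0 := norm_pos_iff.1 hzp
  have hw : dist z⁻¹ 0 < δ := by
    rw [dist_zero_right, norm_inv, inv_lt_comm₀ hzp hδ]
    exact lt_of_lt_of_le (by rw [inv_eq_one_div]; gcongr; norm_num) hz
  obtain ⟨hu, hb⟩ := h4 hw
  refine ⟨(isUnit_smul_one_sub_iff B hz0).2 hu, fun i j => ?_⟩
  rw [inv_smul_one_sub B hz0 hu, Matrix.smul_apply, smul_eq_mul, norm_mul, norm_inv, mul_comm]
  gcongr
  linarith [hb i j, hs i j]

end MatrixInverse

/-! ### Algebra of the symbol and decay of `r` and `q`. -/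

namespace RungeKutta

variable {m : ℕ} {M : RungeKutta m}

theorem Admissible.isUnit_Ac (hM : M.Admissible) : IsUnit M.Ac := by
  have := hM.invertible.map (RingHom.mapMatrix (m := Fin (m + 1)) (Complex.ofRealHom))
  exact this

theorem Admissible.bc_vecMul_inv (hM : M.Admissible) :
    Matrix.vecMul M.bc M.Ac⁻¹ = Pi.single (Fin.last m) 1 := by
  have h1 : M.bc = Matrix.vecMul (Pi.single (Fin.last m) 1) M.Ac := by
    have h2 : M.b = Matrix.vecMul (Pi.single (Fin.last m) 1) M.A := by
      rw [← hM.stiffly_accurate, Matrix.vecMul_vecMul, Matrix.nonsing_inv_mul _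
        ((Matrix.isUnit_iff_isUnit_det _).1 hM.invertible), Matrix.vecMul_one]
    ext j
    have := congrFun h2 j
    simp only [Matrix.single_one_vecMul] at this ⊢
    simp [bc, Ac, this]
  rw [h1, Matrix.vecMul_vecMul, Matrix.mul_nonsing_inv _
        ((Matrix.isUnit_iff_isUnit_det _).1 hM.isUnit_Ac), Matrix.vecMul_one]

theorem Admissible.bc_eq (hM : M.Admissible) : M.bc = M.Ac (Fin.last m) := by
  have h := congrArg (fun v => Matrix.vecMul v M.Ac) hM.bc_vecMul_inv
  simp only [Matrix.vecMul_vecMul, Matrix.nonsing_inv_mul _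
        ((Matrix.isUnit_iff_isUnit_det _).1 hM.isUnit_Ac), Matrix.vecMul_one,
        Matrix.single_one_vecMul] at h
  exact h

/-- Sherman–Morrison: since $b^TA^{-1}$ is the last unit row and its product with $\mathbb 1$ is
$1$, the inverse of the rank-one update becomes affine in $\zeta$. -/
theorem Admissible.symbol_eq (hM : M.Admissible) {ζ : ℂ} (hζ : ζ ≠ 1) :
    M.symbol ζ = M.Ac⁻¹ - ζ • vecMulVec (M.Ac⁻¹ *ᵥ 1) (Pi.single (Fin.last m) 1) := by
  have h1 : 1 - ζ ≠ 0 := sub_ne_zero.2 hζ.symm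
  have hA := Matrix.mul_nonsing_inv _ ((Matrix.isUnit_iff_isUnit_det _).1 hM.isUnit_Ac)
  rw [symbol]
  apply Matrix.inv_eq_right_inv
  rw [add_mul, mul_sub, mul_sub, hA, mul_smul_comm, mul_smul_comm, smul_mul_assoc, smul_mul_assoc,
    Matrix.mul_vecMulVec, Matrix.mulVec_mulVec, hA, Matrix.one_mulVec, Matrix.vecMulVec_mul,
    hM.bc_vecMul_inv, Matrix.vecMulVec_mul_vecMulVec, Matrix.dotProduct_mulVec, hM.bc_vecMul_inv]
  have : (Pi.single (Fin.last m) (1 : ℂ) ⬝ᵥ (1 : Fin (m + 1) → ℂ)) = 1 := by simp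
  rw [this, one_smul, ← sub_eq_zero]
  have h2 : ζ / (1 - ζ) - ζ - ζ * (ζ / (1 - ζ)) = 0 := by field_simp; ring
  set V := vecMulVec (1 : Fin (m + 1) → ℂ) (Pi.single (Fin.last m) (1 : ℂ))
  calc _ = (ζ / (1 - ζ) - ζ - ζ * (ζ / (1 - ζ))) • V := by module
    _ = 0 := by rw [h2, zero_smul]

/-- Stiff accuracy says that $b^T$ is the last row of $A$, so this is the last entry of
$(1-zA)(1-zA)^{-1}\mathbb 1=\mathbb 1$. -/
theorem Admissible.r_eq (hM : M.Admissible) {z : ℂ} (hz : z.re ≤ 0) :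
    M.r z = ((1 - z • M.Ac)⁻¹ *ᵥ 1) (Fin.last m) := by
  have hu := Matrix.mul_nonsing_inv _ ((Matrix.isUnit_iff_isUnit_det _).1 (hM.nonsingular z hz))
  have h := congrArg (fun X => (X *ᵥ (1 : Fin (m + 1) → ℂ)) (Fin.last m)) hu
  simp only [sub_mul, one_mul, Matrix.sub_mulVec, Pi.sub_apply, Matrix.one_mulVec,
    Pi.one_apply, smul_mul_assoc, Matrix.smul_mulVec, Pi.smul_apply, smul_eq_mul] at h
  rw [← Matrix.mulVec_mulVec] at h
  rw [r, hM.bc_eq]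
  change _ - z * (M.Ac (Fin.last m) ⬝ᵥ _) = 1 at h
  rw [← h]; ring

theorem Admissible.one_sub_mul_r_ne_zero (hM : M.Admissible) {ζ z : ℂ} (hζ : ‖ζ‖ < 1)
    (hz : z.re ≤ 0) : 1 - ζ * M.r z ≠ 0 := by
  intro h0
  have h2 : ‖ζ * M.r z‖ = 1 := by rw [← sub_eq_zero.1 h0]; simp
  have := hM.stable z hz
  rw [norm_mul] at h2
  nlinarith [norm_nonneg ζ, norm_nonneg (M.r z)]

/-- Sherman–Morrison again: $\Delta(\zeta)-z$ is a rank-one update of $A^{-1}-z=A^{-1}(1-zA)$, with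
denominator $1-\zeta r(z)$, which A-stability keeps away from zero for $|\zeta|<1$. -/
theorem Admissible.symbol_sub_mul (hM : M.Admissible) {ζ z : ℂ} (hζ : ‖ζ‖ < 1) (hz : z.re ≤ 0) :
    (M.symbol ζ - z • (1 : Matrix (Fin (m + 1)) (Fin (m + 1)) ℂ)) *
      (M.Ac * (1 - z • M.Ac)⁻¹ +
        (ζ / (1 - ζ * M.r z)) • vecMulVec ((1 - z • M.Ac)⁻¹ *ᵥ 1) (M.q z)) = 1 := by
  have h1 := hM.one_sub_mul_r_ne_zero hζ hz
  have hζ1 : ζ ≠ 1 := by rintro rfl; simp at hζ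
  have hu := Matrix.mul_nonsing_inv _ ((Matrix.isUnit_iff_isUnit_det _).1 (hM.nonsingular z hz))
  have hA := Matrix.nonsing_inv_mul _ ((Matrix.isUnit_iff_isUnit_det _).1 hM.isUnit_Ac)
  have hr := hM.r_eq hz
  set P := (1 - z • M.Ac)⁻¹ with hP
  have e1 : (M.Ac⁻¹ - z • (1 : Matrix (Fin (m + 1)) (Fin (m + 1)) ℂ)) = M.Ac⁻¹ * (1 - z • M.Ac) := by
    rw [mul_sub, mul_one, mul_smul_comm, hA]
  have hcomm : (1 - z • M.Ac) * M.Ac = M.Ac * (1 - z • M.Ac) := by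
    simp [sub_mul, mul_sub]
  have e2 : (M.Ac⁻¹ - z • (1 : Matrix (Fin (m + 1)) (Fin (m + 1)) ℂ)) * (M.Ac * P) = 1 := by
    rw [e1, mul_assoc, ← mul_assoc _ M.Ac, hcomm, mul_assoc, hu, mul_one, hA]
  have e3 : (M.Ac⁻¹ - z • (1 : Matrix (Fin (m + 1)) (Fin (m + 1)) ℂ)) *ᵥ (P *ᵥ 1) =
      M.Ac⁻¹ *ᵥ 1 := by
    rw [Matrix.mulVec_mulVec, e1, mul_assoc, hu, mul_one]
  have e4 : Matrix.vecMul (Pi.single (Fin.last m) 1) (M.Ac * P) = M.q z := by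
    rw [q, ← Matrix.vecMul_vecMul, Matrix.single_one_vecMul, hM.bc_eq]; rfl
  have e5 : (Pi.single (Fin.last m) 1) ⬝ᵥ (P *ᵥ 1) = M.r z := by
    rw [hr]; simp
  rw [hM.symbol_eq hζ1, sub_right_comm, sub_mul, mul_add, mul_add, e2, mul_smul_comm,
    Matrix.mul_vecMulVec, e3, smul_mul_assoc, smul_mul_assoc, Matrix.vecMulVec_mul, e4,
    mul_smul_comm, Matrix.vecMulVec_mul_vecMulVec, e5, Matrix.vecMulVec_smul]
  set V := vecMulVec (M.Ac⁻¹ *ᵥ 1) (M.q z)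
  have e7 : ζ / (1 - ζ * M.r z) - ζ - ζ * (ζ / (1 - ζ * M.r z) * M.r z) = 0 := by
    field_simp; ring
  rw [← sub_eq_zero]
  calc _ = (ζ / (1 - ζ * M.r z) - ζ - ζ * (ζ / (1 - ζ * M.r z) * M.r z)) • V := by module
    _ = 0 := by rw [e7, zero_smul]

theorem Admissible.isUnit_symbol_sub (hM : M.Admissible) {ζ z : ℂ} (hζ : ‖ζ‖ < 1)
    (hz : z.re ≤ 0) :
    IsUnit (M.symbol ζ - z • (1 : Matrix (Fin (m + 1)) (Fin (m + 1)) ℂ)) :=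
  (Matrix.isUnit_iff_isUnit_det _).2
    (Matrix.isUnit_det_of_right_inverse (hM.symbol_sub_mul hζ hz))

/-- In the last row the two terms of the inverse are both multiples of $q(z)$, and $1+\zeta
r/(1-\zeta r)=1/(1-\zeta r)$. -/
theorem Admissible.symbol_sub_inv_last (hM : M.Admissible) {ζ z : ℂ} (hζ : ‖ζ‖ < 1)
    (hz : z.re ≤ 0) (j : Fin (m + 1)) :
    (M.symbol ζ - z • (1 : Matrix (Fin (m + 1)) (Fin (m + 1)) ℂ))⁻¹ (Fin.last m) j =
      M.q z j * (1 - ζ * M.r z)⁻¹ := by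
  have h1 := hM.one_sub_mul_r_ne_zero hζ hz
  rw [Matrix.inv_eq_right_inv (hM.symbol_sub_mul hζ hz)]
  have e1 : (M.Ac * (1 - z • M.Ac)⁻¹) (Fin.last m) j = M.q z j := by
    rw [q, hM.bc_eq]; rfl
  rw [Matrix.add_apply, e1, Matrix.smul_apply, Matrix.vecMulVec_apply, ← hM.r_eq hz, smul_eq_mul]
  field_simp
  ring

theorem powerCoeff_apply_of_hasSum {ι : Type*} {F : ℂ → Matrix ι ι ℂ} {i j : ι} {c : ℕ → ℂ}
    (hF : ∀ ζ : ℂ, ‖ζ‖ < 1 → HasSum (fun n => c n * ζ ^ n) (F ζ i j)) (n : ℕ) :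
    powerCoeff F n i j = c n := by
  have h : HasFPowerSeriesAt (fun ζ => F ζ i j) (FormalMultilinearSeries.ofScalars ℂ c) 0 := by
    rw [hasFPowerSeriesAt_iff]
    filter_upwards [Metric.ball_mem_nhds (0 : ℂ) one_pos] with ζ hζ
    simpa [FormalMultilinearSeries.coeff_ofScalars, mul_comm] using hF ζ (by simpa using hζ)
  have h2 := h.eq_formalMultilinearSeries h.analyticAt.hasFPowerSeriesAt
  have h3 := congrArg (fun p => FormalMultilinearSeries.coeff p n) h2
  simp only [FormalMultilinearSeries.coeff_ofScalars] at h3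
  rw [powerCoeff, Matrix.of_apply, h3]

theorem Admissible.e_eq (hM : M.Admissible) (n : ℕ) {z : ℂ} (hz : z.re ≤ 0) (j : Fin (m + 1)) :
    M.e n z j = M.r z ^ n * M.q z j := by
  rw [e, resolventMatrix]
  refine powerCoeff_apply_of_hasSum (c := fun n => M.r z ^ n * M.q z j) (fun ζ hζ => ?_) n
  rw [hM.symbol_sub_inv_last hζ hz]
  have hlt : ‖ζ * M.r z‖ < 1 := by
    rw [norm_mul]
    nlinarith [norm_nonneg ζ, norm_nonneg (M.r z), hM.stable z hz]
  have := (hasSum_geometric_of_norm_lt_one hlt).mul_left (M.q z j)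
  refine (funext fun k => ?_ : (fun k => M.q z j * (ζ * M.r z) ^ k) =
    fun k => M.r z ^ k * M.q z j * ζ ^ k) ▸ this
  rw [mul_pow]; ring

theorem Admissible.differentiableAt_inv (hM : M.Admissible) {z : ℂ} (hz : z.re ≤ 0)
    (i j : Fin (m + 1)) : DifferentiableAt ℂ (fun w : ℂ => (1 - w • M.Ac)⁻¹ i j) z := by
  refine differentiableAt_inv_entry (fun i j => ?_) (hM.nonsingular z hz) i j
  simp only [Matrix.sub_apply, Matrix.smul_apply, smul_eq_mul]
  fun_prop

theorem Admissible.differentiableAt_q (hM : M.Admissible) {z : ℂ} (hz : z.re ≤ 0)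
    (j : Fin (m + 1)) : DifferentiableAt ℂ (fun w : ℂ => M.q w j) z := by
  simp only [q, Matrix.vecMul, dotProduct]
  exact DifferentiableAt.fun_sum fun i _ => (hM.differentiableAt_inv hz i j).const_mul _

theorem Admissible.differentiableAt_r (hM : M.Admissible) {z : ℂ} (hz : z.re ≤ 0) :
    DifferentiableAt ℂ M.r z := by
  unfold r
  simp only [Matrix.mulVec, dotProduct, Pi.one_apply, mul_one]
  refine (differentiableAt_const _).add (differentiableAt_id.mul ?_)
  exact DifferentiableAt.fun_sum fun i _ => (DifferentiableAt.fun_sum fun j _ =>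
    (hM.differentiableAt_inv hz i j)).const_mul _

/-- For large $|z|$, invertibility of $A$ gives $(1-zA)^{-1}=-A^{-1}(z-A^{-1})^{-1}$, which decays
as a resolvent; on the remaining compact half-disc continuity suffices. -/
theorem Admissible.exists_inv_bound (hM : M.Admissible) :
    ∃ C : ℝ, 0 < C ∧ ∀ z : ℂ, z.re ≤ 0 → z ≠ 0 → ∀ i j,
      ‖(1 - z • M.Ac)⁻¹ i j‖ ≤ C * ‖z‖⁻¹ := by
  have hdA := (Matrix.isUnit_iff_isUnit_det _).1 hM.isUnit_Ac
  obtain ⟨R, C₁, hR, hC₁, hb⟩ := exists_resolvent_bound M.Ac⁻¹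
  have hinf : ∀ z : ℂ, R ≤ ‖z‖ → ∀ i j, ‖(1 - z • M.Ac)⁻¹ i j‖ ≤
      (∑ k, ∑ l, ‖M.Ac⁻¹ k l‖ * C₁) * ‖z‖⁻¹ := by
    intro z hz i j
    obtain ⟨hu, hb⟩ := hb z hz
    have h1 : (1 - z • M.Ac)⁻¹ =
        -(M.Ac⁻¹ * (z • (1 : Matrix (Fin (m + 1)) (Fin (m + 1)) ℂ) - M.Ac⁻¹)⁻¹) := by
      have : (1 - z • M.Ac) = (z • (1 : Matrix (Fin (m + 1)) (Fin (m + 1)) ℂ) - M.Ac⁻¹) * (-M.Ac) := by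
        simp [sub_mul, Matrix.nonsing_inv_mul _ hdA]
      rw [this, Matrix.mul_inv_rev, ← neg_mul]
      congr 1
      exact Matrix.inv_eq_right_inv (by simp [Matrix.mul_nonsing_inv _ hdA])
    rw [h1, Matrix.neg_apply, norm_neg, Matrix.mul_apply, Finset.sum_mul]
    calc _ ≤ ∑ k, ‖M.Ac⁻¹ i k‖ * (C₁ * ‖z‖⁻¹) := norm_sum_le_of_le _ fun k _ => by
            rw [norm_mul]; gcongr; exact hb k j
      _ = (∑ k, ‖M.Ac⁻¹ i k‖ * C₁) * ‖z‖⁻¹ := by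
            rw [Finset.sum_mul]; simp only [mul_assoc]
      _ ≤ _ := Finset.single_le_sum
        (f := fun i => (∑ k, ‖M.Ac⁻¹ i k‖ * C₁) * ‖z‖⁻¹)
        (fun _ _ => by positivity) (Finset.mem_univ i)
  have hcomp : IsCompact (Metric.closedBall (0 : ℂ) R ∩ {z : ℂ | z.re ≤ 0}) :=
    (isCompact_closedBall 0 R).inter_right (isClosed_le continuous_re continuous_const)
  have hbd : ∀ i j, ∃ C : ℝ, ∀ z ∈ Metric.closedBall (0 : ℂ) R ∩ {z : ℂ | z.re ≤ 0},
      ‖(1 - z • M.Ac)⁻¹ i j‖ ≤ C := fun i j => hcomp.exists_bound_of_continuousOn fun z hz =>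
    (hM.differentiableAt_inv hz.2 i j).continuousAt.continuousWithinAt
  choose C₂ hC₂ using hbd
  refine ⟨(∑ k, ∑ l, ‖M.Ac⁻¹ k l‖ * C₁) + (∑ k, ∑ l, |C₂ k l| * R) + 1, by positivity,
    fun z hz hz0 i j => ?_⟩
  have hzp := norm_pos_iff.2 hz0
  have hle : |C₂ i j| * R ≤ ∑ k, ∑ l, |C₂ k l| * R :=
    (Finset.single_le_sum (f := fun l => |C₂ i l| * R)
      (fun _ _ => by positivity) (Finset.mem_univ j)).trans
    (Finset.single_le_sum (f := fun k => ∑ l, |C₂ k l| * R)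
      (fun _ _ => Finset.sum_nonneg fun _ _ => by positivity) (Finset.mem_univ i))
  have h0 : 0 ≤ ∑ k, ∑ l, ‖M.Ac⁻¹ k l‖ * C₁ := by positivity
  rcases le_total R ‖z‖ with h | h
  · refine (hinf z h i j).trans ?_
    gcongr
    have : 0 ≤ |C₂ i j| * R := by positivity
    linarith
  · have h1 := hC₂ i j z ⟨by simpa using h, hz⟩
    calc _ ≤ |C₂ i j| := h1.trans (le_abs_self _)
      _ = |C₂ i j| * ‖z‖ * ‖z‖⁻¹ := by field_simp
      _ ≤ |C₂ i j| * R * ‖z‖⁻¹ := by gcongr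
      _ ≤ _ := by gcongr; linarith

theorem Admissible.exists_isDecayConstant (hM : M.Admissible)
    (N : Seminorm ℂ (Fin (m + 1) → ℂ)) : ∃ C : ℝ, M.IsDecayConstant N C := by
  obtain ⟨C, hC, hb⟩ := hM.exists_inv_bound
  have hq : ∀ z : ℂ, z.re ≤ 0 → z ≠ 0 → ∀ j, ‖M.q z j‖ ≤ (∑ i, ‖M.bc i‖ * C) * ‖z‖⁻¹ := by
    intro z hz hz0 j
    simp only [q, Matrix.vecMul, dotProduct]
    rw [Finset.sum_mul]
    refine norm_sum_le_of_le _ fun i _ => ?_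
    rw [norm_mul, mul_assoc]
    gcongr
    exact hb z hz hz0 i j
  have hr : ∀ z : ℂ, z.re ≤ 0 → z ≠ 0 → ‖M.r z‖ ≤ ((m + 1) * C) * ‖z‖⁻¹ := by
    intro z hz hz0
    rw [hM.r_eq hz]
    simp only [Matrix.mulVec, dotProduct, Pi.one_apply, mul_one]
    refine (norm_sum_le_of_le _ fun j _ => hb z hz hz0 _ j).trans ?_
    simp [mul_assoc]
  -- A seminorm in finite dimension is controlled by the coordinates, so the entrywise decay of $q$
  -- passes to `N`.
  have hN : ∀ v : Fin (m + 1) → ℂ, N v ≤ ∑ j, ‖v j‖ * N (Pi.single j 1) := by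
    intro v
    have hv : v = ∑ j, v j • (Pi.single j 1 : Fin (m + 1) → ℂ) := by
      ext k; simp [Finset.sum_apply, Pi.single_apply]
    conv_lhs => rw [hv]
    refine (Finset.le_sum_of_subadditive N (map_zero N).le (map_add_le_add N) _ _).trans
      (Finset.sum_le_sum fun j _ => ?_)
    rw [map_smul_eq_mul]
  have hNn : ∀ v, 0 ≤ N v := apply_nonneg N
  refine ⟨(m + 1) * C + ∑ j, (∑ i, ‖M.bc i‖ * C) * N (Pi.single j 1), ?_, fun z hz hz0 => ?_⟩
  · have : 0 ≤ ∑ j, (∑ i, ‖M.bc i‖ * C) * N (Pi.single j 1) :=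
      Finset.sum_nonneg fun j _ => mul_nonneg (by positivity) (hNn _)
    positivity
  · have h0 : 0 ≤ ∑ j, (∑ i, ‖M.bc i‖ * C) * N (Pi.single j 1) :=
      Finset.sum_nonneg fun j _ => mul_nonneg (by positivity) (hNn _)
    refine max_le ((hr z hz hz0).trans ?_) ((hN _).trans ?_)
    · gcongr; linarith
    · calc _ ≤ ∑ j, (∑ i, ‖M.bc i‖ * C) * ‖z‖⁻¹ * N (Pi.single j 1) := by
            refine Finset.sum_le_sum fun j _ => ?_
            exact mul_le_mul_of_nonneg_right (hq z hz hz0 j) (hNn _)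
        _ = (∑ j, (∑ i, ‖M.bc i‖ * C) * N (Pi.single j 1)) * ‖z‖⁻¹ := by
            symm
            exact (Finset.sum_mul ..).trans (Finset.sum_congr rfl fun j _ => by ring)
        _ ≤ _ := by
            gcongr
            have : 0 ≤ ((m : ℝ) + 1) * C := by positivity
            linarith

end RungeKutta

/-! ### The stability function in the left half-plane and positivity of `gamma`. -/

namespace RungeKutta

variable {m : ℕ} {M : RungeKutta m}

theorem Admissible.exists_norm_r_le (hM : M.Admissible) :
    ∃ C : ℝ, 0 < C ∧ ∀ z : ℂ, z.re ≤ 0 → z ≠ 0 → ‖M.r z‖ ≤ C * ‖z‖⁻¹ := by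
  obtain ⟨C, hC, hb⟩ := hM.exists_isDecayConstant 0
  exact ⟨C, hC, fun z hz hz0 => (le_max_left _ _).trans (hb z hz hz0)⟩

/-- Maximum principle: an interior point with $|r|=1$ would force $|r|=1$ on the whole half-plane,
against the decay $|r(z)|\le C/|z|$ at $z=-(C+1)$. -/
theorem Admissible.norm_r_lt_one (hM : M.Admissible) {z : ℂ} (hz : z.re < 0) : ‖M.r z‖ < 1 := by
  refine (hM.stable z hz.le).lt_of_ne fun h1 => ?_
  obtain ⟨C, hC, hb⟩ := hM.exists_norm_r_le
  have hmax : IsMaxOn (norm ∘ M.r) {w : ℂ | w.re < 0} z := fun w hw => by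
    simpa [h1] using hM.stable w (le_of_lt hw)
  have hconv : Convex ℝ {w : ℂ | w.re < 0} := convex_halfSpace_re_lt 0
  have hw : ((-(C + 1) : ℝ) : ℂ) ∈ {w : ℂ | w.re < 0} := by
    simp only [Set.mem_ofPred_eq, ofReal_re]; linarith
  have h2 := Complex.norm_eqOn_of_isPreconnected_of_isMaxOn hconv.isPreconnected
    (isOpen_lt continuous_re continuous_const)
    (fun w hw => (hM.differentiableAt_r (le_of_lt hw)).differentiableWithinAt) hz hmax hw
  simp only [Function.comp_apply, Function.const_apply, h1] at h2
  have h3 := hb _ (le_of_lt hw) (by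
    rw [ofReal_ne_zero]; linarith)
  rw [h2, norm_real, norm_neg, Real.norm_of_nonneg (by positivity)] at h3
  have : C * (C + 1)⁻¹ < 1 := by
    rw [← div_eq_mul_inv, div_lt_one (by positivity)]; linarith
  linarith

theorem Admissible.exists_norm_r_le_on_line (hM : M.Admissible) {a : ℝ} (ha : 0 < a) :
    ∃ ρ : ℝ, 0 < ρ ∧ ρ < 1 ∧ ∀ z : ℂ, z.re = -a → ‖M.r z‖ ≤ ρ := by
  obtain ⟨C, hC, hb⟩ := hM.exists_norm_r_le
  have hK : IsCompact (Metric.closedBall (0 : ℂ) (max (2 * C) a) ∩ {z : ℂ | z.re = -a}) :=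
    (isCompact_closedBall _ _).inter_right (isClosed_eq continuous_re continuous_const)
  have hne : (Metric.closedBall (0 : ℂ) (max (2 * C) a) ∩ {z : ℂ | z.re = -a}).Nonempty :=
    ⟨((-a : ℝ) : ℂ), by simp [abs_of_pos ha]⟩
  obtain ⟨z₀, hz₀, hmax⟩ := hK.exists_isMaxOn hne (f := fun z => ‖M.r z‖) fun z hz =>
    ((hM.differentiableAt_r (by rw [hz.2]; linarith)).continuousAt.norm).continuousWithinAt
  -- The value $1/2$ dominates $|r|$ outside the ball, where $|z|\ge 2C$, and also keeps $\rho$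
  -- positive so that $\log\rho$ is meaningful.
  refine ⟨max ‖M.r z₀‖ (1 / 2), by positivity, max_lt (hM.norm_r_lt_one ?_) (by norm_num),
    fun z hz => ?_⟩
  · rw [hz₀.2]; linarith
  · rcases le_total ‖z‖ (max (2 * C) a) with h | h
    · exact (hmax ⟨by simpa using h, hz⟩).trans (le_max_left _ _)
    · refine le_trans ?_ (le_max_right _ _)
      have h2 : 2 * C ≤ ‖z‖ := (le_max_left _ _).trans h
      have hp : 0 < ‖z‖ := by linarith
      refine (hb z (by rw [hz]; linarith) (norm_pos_iff.1 hp)).trans ?_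
      rw [← div_eq_mul_inv, div_le_iff₀ hp]
      linarith

/-- In a vertical strip, the stability function is dominated by an exponential. -/
theorem Admissible.exists_log_norm_r_div_ge (hM : M.Admissible) {a : ℝ} (ha : 0 < a) :
    ∃ c : ℝ, 0 < c ∧ ∀ z : ℂ, -a ≤ z.re → z.re < 0 → M.r z ≠ 0 →
      c ≤ Real.log ‖M.r z‖ / z.re := by
  obtain ⟨ρ, hρ0, hρ1, hb⟩ := hM.exists_norm_r_le_on_line ha
  refine ⟨-Real.log ρ / a, div_pos (neg_pos.2 (Real.log_neg hρ0 hρ1)) ha, fun z hz1 hz2 hz3 => ?_⟩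
  have hcont : ContinuousOn M.r {z : ℂ | z.re ≤ 0} := fun w hw =>
    (hM.differentiableAt_r hw).continuousAt.continuousWithinAt
  -- Interpolating between $\rho$ on $\Re z=-a$ and $1$ on the imaginary axis gives
  -- $|r(z)|\le\rho^{-\Re z/a}$.
  have h3 := HadamardThreeLines.norm_le_interp_of_mem_verticalClosedStrip' (f := M.r) (z := z)
    (a := ρ) (b := 1) (l := -a) (u := 0) (by linarith) ⟨hz1, hz2.le⟩
    (DiffContOnCl.mk (fun w hw => (hM.differentiableAt_r hw.2.le).differentiableWithinAt)
      (hcont.mono ((closure_mono fun w (hw : w ∈ HadamardThreeLines.verticalStrip _ _) =>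
        show w ∈ {z : ℂ | z.re ≤ 0} from hw.2.le).trans
        (isClosed_le continuous_re continuous_const).closure_subset)))
    ⟨1, by rintro _ ⟨w, hw, rfl⟩; exact hM.stable w hw.2⟩
    (fun w hw => hb w hw) (fun w hw => hM.stable w (le_of_eq hw))
  rw [Real.one_rpow, mul_one] at h3
  have h4 := Real.log_le_log (norm_pos_iff.2 hz3) h3
  rw [Real.log_rpow hρ0] at h4
  have h5 : (1 - (z.re - -a) / (0 - -a)) = -z.re / a := by
    rw [sub_neg_eq_add, zero_sub, neg_neg]; field_simp; ring
  rw [h5] at h4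
  rw [le_div_iff_of_neg hz2]
  calc _ ≤ _ := h4
    _ = _ := by ring

theorem Admissible.gamma_pos (hM : M.Admissible) {a : ℝ} (ha : 0 < a) : 0 < M.gamma a := by
  obtain ⟨c, hc, hb⟩ := hM.exists_log_norm_r_div_ge ha
  refine hc.trans_le (le_csInf ?_ ?_)
  -- The infimum of the empty set is $0$ by convention, so an admissible point is needed: $r(0)=1$,
  -- hence $r\ne0$ slightly to the left of $0$.
  · have h0 : M.r 0 ≠ 0 := by simp [r]
    have h1 := (hM.differentiableAt_r (z := 0) (by simp)).continuousAt.eventually_ne h0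
    obtain ⟨δ, hδ, h2⟩ := Metric.eventually_nhds_iff.1 h1
    have hmin : 0 < min a (δ / 2) := by positivity
    refine ⟨_, ((-(min a (δ / 2)) : ℝ) : ℂ), ?_, ?_, h2 ?_, rfl⟩
    · simp
    · simpa using ⟨ha, hδ⟩
    · rw [dist_zero_right, norm_real, norm_neg, Real.norm_of_nonneg hmin.le]
      exact (min_le_right _ _).trans_lt (by linarith)
  · rintro t ⟨z, hz1, hz2, hz3, rfl⟩
    exact hb z hz1 hz2 hz3

theorem Admissible.norm_r_le_exp (hM : M.Admissible) {a : ℝ} (ha : 0 < a) {z : ℂ}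
    (hz : z.re = -a) : ‖M.r z‖ ≤ Real.exp (-(a * M.gamma a)) := by
  by_cases h0 : M.r z = 0
  · rw [h0, norm_zero]; positivity
  have hz2 : z.re < 0 := by rw [hz]; linarith
  have h1 : M.gamma a ≤ Real.log ‖M.r z‖ / z.re := by
    refine csInf_le ⟨0, ?_⟩ ⟨z, hz.ge, hz2, h0, rfl⟩
    rintro t ⟨w, -, hw2, -, rfl⟩
    exact div_nonneg_of_nonpos (Real.log_nonpos (norm_nonneg _) (hM.stable w hw2.le)) hw2.le
  rw [le_div_iff_of_neg hz2, hz] at h1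
  rw [← Real.log_le_iff_le_exp (norm_pos_iff.2 h0)]
  linarith

end RungeKutta

/-! ### Matrix functions through Hermite interpolation. -/

section Interpolation

/-- Newton interpolation of a holomorphic function, with holomorphic remainder. -/
theorem exists_newton_interpolation {U : Set ℂ} (hU : IsOpen U) (s : Multiset ℂ)
    (hs : ∀ a ∈ s, a ∈ U) {f : ℂ → ℂ} (hf : DifferentiableOn ℂ f U) :
    ∃ (p : Polynomial ℂ) (g : ℂ → ℂ), DifferentiableOn ℂ g U ∧ ∀ z ∈ U,
      f z = p.eval z + g z * ((s.map fun a => Polynomial.X - Polynomial.C a).prod).eval z := by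
  induction s using Multiset.induction_on with
  | empty => exact ⟨0, f, hf, by simp⟩
  | cons a s ih =>
    obtain ⟨p, g, hg, h⟩ := ih fun b hb => hs b (Multiset.mem_cons_of_mem hb)
    have ha : U ∈ 𝓝 a := hU.mem_nhds (hs a (Multiset.mem_cons_self a s))
    -- One more Newton step: the divided difference of `g` at `a` is again holomorphic, and the
    -- factor $z-a$ joins the product.
    refine ⟨p + Polynomial.C (g a) * (s.map fun a => Polynomial.X - Polynomial.C a).prod,
      dslope g a, (Complex.differentiableOn_dslope ha).2 hg, fun z hz => ?_⟩
    have h1 : g z = g a + (z - a) * dslope g a z := by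
      have := sub_smul_dslope g a z
      rw [smul_eq_mul] at this
      rw [this]; ring
    rw [h z hz, h1]
    simp only [Multiset.map_cons, Multiset.prod_cons, Polynomial.eval_mul, Polynomial.eval_add,
      Polynomial.eval_C, Polynomial.eval_sub, Polynomial.eval_X]
    have h2 : dslope g a z * (z - a) = (z - a) * dslope g a z := mul_comm _ _
    ring

theorem iteratedDeriv_polynomial_eval (p : Polynomial ℂ) (k : ℕ) :
    iteratedDeriv k (fun z => p.eval z) = fun z => (Polynomial.derivative^[k] p).eval z := by
  induction k with
  | zero => simp
  | succ k ih =>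
    rw [iteratedDeriv_succ, ih, Function.iterate_succ_apply']
    ext z
    simp

variable {ι : Type*} [Fintype ι] [DecidableEq ι]

theorem charpoly_eq_prod_roots (B : Matrix ι ι ℂ) :
    (B.charpoly.roots.map fun a => Polynomial.X - Polynomial.C a).prod = B.charpoly :=
  ((IsAlgClosed.splits B.charpoly).eq_prod_roots_of_monic B.charpoly_monic).symm

/-- Newton interpolation at the eigenvalues, repeated with multiplicity, makes $f-p$ a holomorphic
multiple of the characteristic polynomial. It therefore vanishes at each eigenvalue to the order of
its multiplicity. -/
theorem exists_isMatrixFunction {U : Set ℂ} (hU : IsOpen U) {f : ℂ → ℂ}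
    (hf : DifferentiableOn ℂ f U) {B : Matrix ι ι ℂ} (hB : ∀ a, B.charpoly.IsRoot a → a ∈ U) :
    ∃ (p : Polynomial ℂ) (g : ℂ → ℂ), DifferentiableOn ℂ g U ∧
      (∀ z ∈ U, f z = p.eval z + g z * B.charpoly.eval z) ∧
      IsMatrixFunction f B (Polynomial.aeval B p) := by
  have hne := B.charpoly_monic.ne_zero
  obtain ⟨p, g, hg, h⟩ := exists_newton_interpolation hU B.charpoly.roots
    (fun a ha => hB a ((Polynomial.mem_roots hne).1 ha)) hf
  rw [charpoly_eq_prod_roots] at h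
  refine ⟨p, g, hg, h, p, rfl, fun μ k hk => ?_⟩
  have hμ : μ ∈ U := hB μ ((Polynomial.rootMultiplicity_pos hne).1 (by omega))
  have hUμ := hU.mem_nhds hμ
  have hfa : AnalyticAt ℂ f μ := hf.analyticAt hUμ
  have hpa : AnalyticAt ℂ (fun z => p.eval z) μ := by
    simpa using (AnalyticAt.aeval_polynomial (analyticAt_id (𝕜 := ℂ) (z := μ)) p)
  obtain ⟨q, hq⟩ := Polynomial.pow_rootMultiplicity_dvd B.charpoly μ
  have hqa : AnalyticAt ℂ (fun z => q.eval z) μ := by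
    simpa using (AnalyticAt.aeval_polynomial (analyticAt_id (𝕜 := ℂ) (z := μ)) q)
  have hord : (B.charpoly.rootMultiplicity μ : ℕ∞) ≤ analyticOrderAt (f - fun z => p.eval z) μ := by
    rw [natCast_le_analyticOrderAt (hfa.sub hpa)]
    refine ⟨fun z => g z * q.eval z, (hg.analyticAt hUμ).mul hqa, ?_⟩
    filter_upwards [hUμ] with z hz
    have h1 := congrArg (Polynomial.eval z) hq
    simp only [Polynomial.eval_mul, Polynomial.eval_pow, Polynomial.eval_sub, Polynomial.eval_X,
      Polynomial.eval_C] at h1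
    rw [Pi.sub_apply, h z hz, smul_eq_mul, h1]
    ring
  have h2 := (natCast_le_analyticOrderAt_iff_iteratedDeriv_eq_zero (hfa.sub hpa)).1 hord k hk
  rw [iteratedDeriv_sub hfa.contDiffAt hpa.contDiffAt, iteratedDeriv_polynomial_eval,
    sub_eq_zero] at h2
  exact h2.symm

/-- Two interpolants differ by a multiple of the characteristic polynomial, which annihilates $B$ by
Cayley–Hamilton. -/
theorem IsMatrixFunction.unique {f : ℂ → ℂ} {B F G : Matrix ι ι ℂ} (hF : IsMatrixFunction f B F)
    (hG : IsMatrixFunction f B G) : F = G := by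
  obtain ⟨p, rfl, hp⟩ := hF
  obtain ⟨q, rfl, hq⟩ := hG
  rw [← sub_eq_zero, ← map_sub]
  by_cases h0 : p - q = 0
  · rw [h0, map_zero]
  have hne := B.charpoly_monic.ne_zero
  have hdvd : B.charpoly ∣ p - q := by
    refine (IsAlgClosed.splits B.charpoly).dvd_of_roots_le_roots hne ?_
    rw [Multiset.le_iff_count]
    intro a
    rw [Polynomial.count_roots, Polynomial.count_roots]
    by_contra! hlt
    have h1 : ∀ k ≤ (p - q).rootMultiplicity a, (Polynomial.derivative^[k] (p - q)).IsRoot a := by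
      intro k hk
      rw [Polynomial.IsRoot, Polynomial.iterate_derivative_sub, Polynomial.eval_sub,
        hp a k (by omega), hq a k (by omega), sub_self]
    exact lt_irrefl _ ((Polynomial.lt_rootMultiplicity_iff_isRoot_iterate_derivative h0).2 h1)
  obtain ⟨c, hc⟩ := hdvd
  rw [hc, map_mul, Matrix.aeval_self_charpoly, zero_mul]

theorem matrixFunction_eq {f : ℂ → ℂ} {B F : Matrix ι ι ℂ} (hF : IsMatrixFunction f B F) :
    matrixFunction f B = F :=
  IsMatrixFunction.unique (Classical.epsilon_spec ⟨F, hF⟩) hF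

/-- Polynomial division of `p(z) - p(B)` by `z - B`. -/
theorem exists_sub_aeval_eq_mul (B : Matrix ι ι ℂ) (p : Polynomial ℂ) :
    ∃ Q : ℂ → Matrix ι ι ℂ, (∀ i j, Differentiable ℂ fun z => Q z i j) ∧ ∀ z,
      p.eval z • (1 : Matrix ι ι ℂ) - Polynomial.aeval B p =
        Q z * (z • (1 : Matrix ι ι ℂ) - B) := by
  induction p using Polynomial.induction_on with
  | C a => exact ⟨0, by simp, by simp [Algebra.algebraMap_eq_smul_one]⟩
  | add p q hp hq =>
    obtain ⟨P, hP, hP'⟩ := hp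
    obtain ⟨Q, hQ, hQ'⟩ := hq
    refine ⟨P + Q, fun i j => (hP i j).add (hQ i j), fun z => ?_⟩
    rw [Pi.add_apply, add_mul, ← hP', ← hQ', Polynomial.eval_add, map_add, add_smul]
    abel
  | monomial n a h =>
    obtain ⟨Q, hQ, hQ'⟩ := h
    refine ⟨fun z => z • Q z + Polynomial.aeval B (Polynomial.C a * Polynomial.X ^ n),
      fun i j => (differentiable_id.mul (hQ i j)).add_const _, fun z => ?_⟩
    rw [add_mul, smul_mul_assoc, ← hQ', pow_succ, ← mul_assoc, map_mul _ _ Polynomial.X,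
      Polynomial.eval_mul, Polynomial.eval_X, Polynomial.aeval_X, mul_sub, mul_smul_comm, mul_one,
      smul_sub, smul_smul, mul_comm z]
    abel

theorem eval_charpoly_eq_det (B : Matrix ι ι ℂ) (z : ℂ) :
    B.charpoly.eval z = (z • (1 : Matrix ι ι ℂ) - B).det := by
  rw [Matrix.eval_charpoly, Matrix.smul_one_eq_diagonal, Matrix.scalar_apply]

theorem isUnit_smul_one_sub_iff_not_isRoot (B : Matrix ι ι ℂ) (z : ℂ) :
    IsUnit (z • (1 : Matrix ι ι ℂ) - B) ↔ ¬ B.charpoly.IsRoot z := by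
  rw [Matrix.isUnit_iff_isUnit_det, isUnit_iff_ne_zero, Polynomial.IsRoot, eval_charpoly_eq_det]

/-- `(f(z) - f(B)) (z - B)⁻¹` has only removable singularities. -/
theorem exists_differentiableOn_sub_matrixFunction_mul_inv {U : Set ℂ} (hU : IsOpen U) {f : ℂ → ℂ}
    (hf : DifferentiableOn ℂ f U) {B : Matrix ι ι ℂ}
    (hB : ∀ a ∉ U, IsUnit (a • (1 : Matrix ι ι ℂ) - B)) :
    ∃ H : ℂ → Matrix ι ι ℂ, (∀ i j, DifferentiableOn ℂ (fun z => H z i j) U) ∧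
      ∀ z ∈ U, IsUnit (z • (1 : Matrix ι ι ℂ) - B) →
        H z = (f z • (1 : Matrix ι ι ℂ) - matrixFunction f B) * (z • (1 : Matrix ι ι ℂ) - B)⁻¹ := by
  obtain ⟨p, g, hg, h, hp⟩ := exists_isMatrixFunction hU hf (B := B) fun a ha => by
    by_contra hn
    exact (isUnit_smul_one_sub_iff_not_isRoot B a).1 (hB a hn) ha
  obtain ⟨Q, hQ, hQ'⟩ := exists_sub_aeval_eq_mul B p
  -- From $f(z)-p(B)=g(z)\det(z-B)+Q(z)(z-B)$: multiplying by $(z-B)^{-1}$ turns the determinant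
  -- into the adjugate, and no pole is left.
  refine ⟨fun z => g z • (z • (1 : Matrix ι ι ℂ) - B).adjugate + Q z, fun i j => ?_,
    fun z hz hu => ?_⟩
  · refine DifferentiableOn.add (hg.mul fun z _ => ?_) (hQ i j).differentiableOn
    refine (differentiableAt_adjugate (fun k l => ?_) i j).differentiableWithinAt
    simp only [Matrix.sub_apply, Matrix.smul_apply, smul_eq_mul]
    fun_prop
  · have hdet := (Matrix.isUnit_iff_isUnit_det _).1 hu
    rw [matrixFunction_eq hp, h z hz, add_smul, add_sub_right_comm, hQ', add_mul, mul_assoc,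
      Matrix.mul_nonsing_inv _ hdet, mul_one, add_comm, eval_charpoly_eq_det, smul_mul_assoc,
      one_mul, Matrix.inv_def, smul_smul, mul_assoc, Ring.mul_inverse_cancel _ hdet, mul_one]

end Interpolation

/-! ### Cauchy's theorem on a half-plane and on a half-strip. -/

section Contour

/-- An integrable function on the half line with an inverse square root singularity at `0`. -/
def decay (t : ℝ) : ℝ := (Real.sqrt t)⁻¹ * (1 + t)⁻¹

theorem decay_nonneg {t : ℝ} (ht : 0 ≤ t) : 0 ≤ decay t := by unfold decay; positivity

theorem decay_anti {s t : ℝ} (hs : 0 < s) (hst : s ≤ t) : decay t ≤ decay s := by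
  unfold decay
  have : 0 < Real.sqrt s := Real.sqrt_pos.2 hs
  have h2 := Real.sqrt_le_sqrt hst
  have h3 : 0 < 1 + t := by linarith
  gcongr

theorem integrableOn_decay : IntegrableOn decay (Ioi 0) := by
  refine integrableOn_Ioi_deriv_of_nonneg (g := fun t => 2 * Real.arctan (Real.sqrt t))
    (l := 2 * (Real.pi / 2)) ?_ (fun t ht => ?_) (fun t ht => decay_nonneg (le_of_lt ht)) ?_
  · exact ((Real.continuous_arctan.comp Real.continuous_sqrt).const_mul 2).continuousWithinAt
  · have ht' : (0 : ℝ) < t := ht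
    have h1 := ((Real.hasDerivAt_arctan (Real.sqrt t)).comp t
      (Real.hasDerivAt_sqrt ht'.ne')).const_mul 2
    refine h1.congr_deriv ?_
    rw [Real.sq_sqrt ht'.le, decay]
    have : Real.sqrt t ≠ 0 := (Real.sqrt_pos.2 ht').ne'
    field_simp
  · refine Tendsto.const_mul 2 ?_
    exact (tendsto_nhds_of_tendsto_nhdsWithin Real.tendsto_arctan_atTop).comp
      Real.tendsto_sqrt_atTop

theorem integrable_decay_abs : Integrable fun y : ℝ => decay |y| := by
  have h1 : Integrable ((Ioi (0 : ℝ)).indicator decay) :=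
    (integrable_indicator_iff measurableSet_Ioi).2 integrableOn_decay
  refine (h1.add h1.comp_neg).congr (Eventually.of_forall fun y => ?_)
  rcases lt_trichotomy y 0 with h | rfl | h
  · simp [h, h.le, abs_of_neg]
  · simp [decay]
  · simp [h, h.le, abs_of_pos]

theorem tendsto_mul_decay : Tendsto (fun R : ℝ => R * decay R) atTop (𝓝 0) := by
  have h1 : Tendsto (fun R : ℝ => (Real.sqrt R)⁻¹) atTop (𝓝 0) :=
    tendsto_inv_atTop_zero.comp Real.tendsto_sqrt_atTop
  refine squeeze_zero' ?_ ?_ h1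
  · filter_upwards [eventually_ge_atTop 0] with R hR
    exact mul_nonneg hR (decay_nonneg hR)
  · filter_upwards [eventually_ge_atTop 0] with R hR
    rw [decay, mul_left_comm]
    refine mul_le_of_le_one_right (by positivity) ?_
    rw [← div_eq_mul_inv, div_le_one (by positivity)]
    linarith

/-- The integral over a horizontal or vertical segment far away is small. -/
theorem norm_intervalIntegral_le_decay {g : ℝ → ℂ} {C R u v : ℝ} (hC : 0 ≤ C) (hR : 0 < R)
    {γ : ℝ → ℂ} (hγ : ∀ t ∈ uIoc u v, R ≤ ‖γ t‖)
    (hg : ∀ t ∈ uIoc u v, ‖g t‖ ≤ C * decay ‖γ t‖) :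
    ‖∫ t in u..v, g t‖ ≤ C * decay R * |v - u| :=
  intervalIntegral.norm_integral_le_of_norm_le_const fun t ht => (hg t ht).trans
    (mul_le_mul_of_nonneg_left (decay_anti hR (hγ t ht)) hC)

/-- Cauchy on the rectangle $[0,R]\times[-R,R]$: the three sides off the axis have total length $4R$
and contribute at most $4CR\cdot$`decay R`, which tends to $0$. -/
theorem integral_imaginaryAxis_eq_zero_of_continuousOn {f : ℂ → ℂ} {C : ℝ}
    (hC : 0 ≤ C) (hc : ContinuousOn f {z | 0 ≤ z.re}) (hd : DifferentiableOn ℂ f {z | 0 < z.re})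
    (hb : ∀ z : ℂ, 0 ≤ z.re → z ≠ 0 → ‖f z‖ ≤ C * decay ‖z‖) :
    ∫ y : ℝ, f (y * I) = 0 := by
  have hcont : Continuous fun y : ℝ => f (y * I) :=
    hc.comp_continuous (by fun_prop) (fun y => by simp)
  have hint : Integrable fun y : ℝ => f (y * I) := by
    refine (integrable_decay_abs.const_mul C).mono' hcont.aestronglyMeasurable ?_
    have : ∀ᵐ y : ℝ, y ≠ 0 := by simp [ae_iff]
    filter_upwards [this] with y hy
    simpa using hb (y * I) (by simp) (by simpa using hy)
  have h1 := intervalIntegral_tendsto_integral hint tendsto_neg_atTop_atBot tendsto_id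
  have h2 : Tendsto (fun R : ℝ => ∫ y in (-R)..R, f (y * I)) atTop (𝓝 0) := by
    have h3 : Tendsto (fun R : ℝ => 4 * C * (R * decay R)) atTop (𝓝 0) := by
      simpa using tendsto_mul_decay.const_mul (4 * C)
    refine squeeze_zero_norm' ?_ h3
    filter_upwards [eventually_gt_atTop 0] with R hR
    have h4 := Complex.integral_boundary_rect_eq_zero_of_continuousOn_of_differentiableOn f
      (⟨0, -R⟩ : ℂ) (⟨R, R⟩ : ℂ)
      (hc.mono fun z hz => by
        rw [mem_reProdIm, uIcc_of_le (by simpa using hR.le)] at hz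
        exact hz.1.1)
      (hd.mono fun z hz => by
        rw [mem_reProdIm] at hz
        have := hz.1.1
        simpa [hR.le] using this)
    simp only [ofReal_zero, zero_add, smul_eq_mul] at h4
    have e1 : ‖∫ x in (0 : ℝ)..R, f (x + ((-R : ℝ) : ℂ) * I)‖ ≤ C * decay R * |R - 0| := by
      refine norm_intervalIntegral_le_decay hC hR (γ := fun x => x + ((-R : ℝ) : ℂ) * I)
        (fun t ht => ?_) (fun t ht => ?_)
      · refine le_trans ?_ (abs_im_le_norm _)
        simp [abs_of_pos hR]
      · rw [uIoc_of_le hR.le] at ht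
        refine hb _ (by simpa using ht.1.le) fun h => ?_
        have := congrArg Complex.re h
        simp at this; linarith [ht.1]
    have e2 : ‖∫ x in (0 : ℝ)..R, f (x + (R : ℂ) * I)‖ ≤ C * decay R * |R - 0| := by
      refine norm_intervalIntegral_le_decay hC hR (γ := fun x => x + (R : ℂ) * I)
        (fun t ht => ?_) (fun t ht => ?_)
      · refine le_trans ?_ (abs_im_le_norm _)
        simp [abs_of_pos hR]
      · rw [uIoc_of_le hR.le] at ht
        refine hb _ (by simpa using ht.1.le) fun h => ?_
        have := congrArg Complex.re h
        simp at this; linarith [ht.1]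
    have e3 : ‖∫ y in (-R)..R, f (R + (y : ℂ) * I)‖ ≤ C * decay R * |R - (-R)| := by
      refine norm_intervalIntegral_le_decay hC hR (γ := fun y => R + (y : ℂ) * I)
        (fun t ht => ?_) (fun t ht => ?_)
      · refine le_trans ?_ (abs_re_le_norm _)
        simp [abs_of_pos hR]
      · refine hb _ (by simpa using hR.le) fun h => ?_
        have := congrArg Complex.re h
        simp at this; linarith
    have e4 : I * ∫ y in (-R)..R, f (y * I) =
        (∫ x in (0 : ℝ)..R, f (x + ((-R : ℝ) : ℂ) * I)) - (∫ x in (0 : ℝ)..R, f (x + (R : ℂ) * I)) +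
        I * ∫ y in (-R)..R, f (R + (y : ℂ) * I) := by linear_combination -h4
    have e5 : ‖∫ y in (-R)..R, f (y * I)‖ = ‖I * ∫ y in (-R)..R, f (y * I)‖ := by simp
    rw [e5, e4]
    refine (norm_add_le _ _).trans ?_
    rw [norm_mul, norm_I, one_mul]
    refine (add_le_add ((norm_sub_le _ _).trans (add_le_add e1 e2)) e3).trans ?_
    rw [sub_zero, sub_neg_eq_add, abs_of_pos hR, abs_of_pos (by linarith)]
    apply le_of_eq; ring
  exact tendsto_nhds_unique h1 h2

theorem norm_le_norm_add_real {z : ℂ} (hz : 0 ≤ z.re) {δ : ℝ} (hδ : 0 ≤ δ) : ‖z‖ ≤ ‖z + δ‖ := by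
  rw [Complex.norm_def, Complex.norm_def]
  refine Real.sqrt_le_sqrt ?_
  simp only [normSq_apply, add_re, ofReal_re, add_im, ofReal_im, add_zero]
  nlinarith

theorem norm_le_norm_add_real_mul_I {z : ℂ} (hz : 0 ≤ z.im) {δ : ℝ} (hδ : 0 ≤ δ) :
    ‖z‖ ≤ ‖z + δ * I‖ := by
  rw [Complex.norm_def, Complex.norm_def]
  refine Real.sqrt_le_sqrt ?_
  simp only [normSq_apply, add_re, mul_re, ofReal_re, I_re, mul_zero, ofReal_im, I_im, sub_self,
    add_zero, add_im, mul_im, mul_one]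
  nlinarith

theorem tendsto_one_div_nat_add_one_complex (c : ℂ) (z : ℂ) :
    Tendsto (fun n : ℕ => z + ((1 / ((n : ℝ) + 1) : ℝ) : ℂ) * c) atTop (𝓝 z) := by
  have h : Tendsto (fun n : ℕ => ((1 / ((n : ℝ) + 1) : ℝ) : ℂ)) atTop (𝓝 ((0 : ℝ) : ℂ)) :=
    (continuous_ofReal.tendsto 0).comp tendsto_one_div_add_atTop_nhds_zero_nat
  simpa using (h.mul_const c).const_add z

/-- Cauchy's theorem on the right half-plane, for integrands that decay at infinity and have at
most an inverse square root singularity at the boundary point `0`. -/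
theorem integral_imaginaryAxis_eq_zero {f : ℂ → ℂ} {C : ℝ}
    (hC : 0 ≤ C) (hc : ContinuousOn f ({z | 0 ≤ z.re} \ {0}))
    (hd : DifferentiableOn ℂ f {z | 0 < z.re})
    (hb : ∀ z : ℂ, 0 ≤ z.re → z ≠ 0 → ‖f z‖ ≤ C * decay ‖z‖) :
    ∫ y : ℝ, f (y * I) = 0 := by
  -- Translating by $1/(n+1)$ to the right removes the singularity from the closed half-plane. It
  -- does not decrease $|z|$, so the same decay bound serves as majorant when $n\to\infty$.
  have hpos : ∀ n : ℕ, (0 : ℝ) < 1 / ((n : ℝ) + 1) := fun n => by positivity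
  have hne : ∀ (z : ℂ) (n : ℕ), 0 ≤ z.re → z + ((1 / ((n : ℝ) + 1) : ℝ) : ℂ) ≠ 0 := by
    intro z n hz h
    have := congrArg Complex.re h
    rw [add_re, ofReal_re, zero_re] at this
    linarith [hpos n]
  have hre : ∀ (z : ℂ) (n : ℕ), 0 ≤ z.re → 0 < (z + ((1 / ((n : ℝ) + 1) : ℝ) : ℂ)).re := by
    intro z n hz
    rw [add_re, ofReal_re]
    linarith [hpos n]
  have hbn : ∀ (n : ℕ) (z : ℂ), 0 ≤ z.re → z ≠ 0 →
      ‖f (z + ((1 / ((n : ℝ) + 1) : ℝ) : ℂ))‖ ≤ C * decay ‖z‖ := fun n z hz hz0 =>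
    (hb _ (hre z n hz).le (hne z n hz)).trans (mul_le_mul_of_nonneg_left
      (decay_anti (norm_pos_iff.2 hz0) (norm_le_norm_add_real hz (hpos n).le)) hC)
  have hcn : ∀ n : ℕ, ContinuousOn (fun z => f (z + ((1 / ((n : ℝ) + 1) : ℝ) : ℂ))) {z | 0 ≤ z.re} :=
    fun n => hc.comp (by fun_prop) fun z hz => ⟨(hre z n hz).le, hne z n hz⟩
  have h0 : ∀ n : ℕ, ∫ y : ℝ, f (y * I + ((1 / ((n : ℝ) + 1) : ℝ) : ℂ)) = 0 := fun n =>
    integral_imaginaryAxis_eq_zero_of_continuousOn hC (hcn n)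
      (hd.comp (by fun_prop) fun z hz => hre z n (le_of_lt hz)) (hbn n)
  have hlim : Tendsto (fun n : ℕ => ∫ y : ℝ, f (y * I + ((1 / ((n : ℝ) + 1) : ℝ) : ℂ))) atTop
      (𝓝 (∫ y : ℝ, f (y * I))) := by
    have hae : ∀ᵐ y : ℝ, y ≠ 0 := by simp [ae_iff]
    refine tendsto_integral_of_dominated_convergence (fun y => C * decay |y|) (fun n => ?_)
      (integrable_decay_abs.const_mul C) (fun n => ?_) ?_
    · exact ((hcn n).comp_continuous (f := fun y : ℝ => (y : ℂ) * I) (by fun_prop)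
        (fun y => by simp)).aestronglyMeasurable
    · filter_upwards [hae] with y hy
      simpa using hbn n (y * I) (by simp) (by simpa using hy)
    · filter_upwards [hae] with y hy
      refine (hc (y * I) ⟨by simp, by simpa using hy⟩).tendsto.comp
        (tendsto_nhdsWithin_iff.2 ⟨?_, Eventually.of_forall fun n =>
          ⟨(hre (y * I) n (by simp)).le, hne (y * I) n (by simp)⟩⟩)
      simpa using tendsto_one_div_nat_add_one_complex 1 (y * I)
  simp only [h0] at hlim
  exact (tendsto_nhds_unique hlim tendsto_const_nhds)

theorem integrableOn_halfLine_of_decay {f : ℂ → ℂ} {C c : ℝ} (hC : 0 ≤ C)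
    (hc : ContinuousOn (fun y : ℝ => f (c + y * I)) (Ioi 0))
    (hb : ∀ y : ℝ, 0 < y → ‖f (c + y * I)‖ ≤ C * decay ‖(c : ℂ) + y * I‖) :
    IntegrableOn (fun y : ℝ => f (c + y * I)) (Ioi 0) := by
  refine (integrableOn_decay.const_mul C).mono' (hc.aestronglyMeasurable measurableSet_Ioi) ?_
  filter_upwards [ae_restrict_mem measurableSet_Ioi] with y hy
  refine (hb y hy).trans (mul_le_mul_of_nonneg_left (decay_anti hy ?_) hC)
  refine le_trans ?_ (abs_im_le_norm _)
  simpa using le_abs_self y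

theorem integral_boundary_halfStrip_eq_zero_of_continuousOn {f : ℂ → ℂ} {a b C : ℝ} (hab : a ≤ b)
    (hC : 0 ≤ C) (hc : ContinuousOn f {z | a ≤ z.re ∧ z.re ≤ b ∧ 0 ≤ z.im})
    (hd : DifferentiableOn ℂ f {z | a < z.re ∧ z.re < b ∧ 0 < z.im})
    (hb : ∀ z : ℂ, a ≤ z.re → z.re ≤ b → 0 ≤ z.im → z ≠ 0 → ‖f z‖ ≤ C * decay ‖z‖) :
    (∫ x in a..b, f x) + I * (∫ y in Ioi (0 : ℝ), f (b + y * I)) -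
      I * ∫ y in Ioi (0 : ℝ), f (a + y * I) = 0 := by
  have hint : ∀ c : ℝ, a ≤ c → c ≤ b → IntegrableOn (fun y : ℝ => f (c + y * I)) (Ioi 0) := by
    intro c hac hcb
    refine integrableOn_halfLine_of_decay hC (hc.comp (by fun_prop) fun y hy => ?_) fun y hy => ?_
    · simpa using ⟨hac, hcb, le_of_lt hy⟩
    · refine hb _ (by simpa using hac) (by simpa using hcb) (by simpa using hy.le) fun h => ?_
      have := congrArg Complex.im h
      simp at this; linarith
  have hlim : ∀ c : ℝ, a ≤ c → c ≤ b → Tendsto (fun R : ℝ => ∫ y in (0 : ℝ)..R, f (c + y * I)) atTop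
      (𝓝 (∫ y in Ioi (0 : ℝ), f (c + y * I))) := fun c hac hcb =>
    intervalIntegral_tendsto_integral_Ioi 0 (hint c hac hcb) tendsto_id
  have htop : Tendsto (fun R : ℝ => ∫ x in a..b, f (x + R * I)) atTop (𝓝 0) := by
    have h3 : Tendsto (fun R : ℝ => C * decay R * |b - a|) atTop (𝓝 0) := by
      have : Tendsto decay atTop (𝓝 0) := by
        refine squeeze_zero' (g := fun R : ℝ => R * decay R) ?_ ?_ tendsto_mul_decay
        · filter_upwards [eventually_ge_atTop 0] with R hR using decay_nonneg hR
        · filter_upwards [eventually_ge_atTop 1] with R hR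
          exact le_mul_of_one_le_left (decay_nonneg (by linarith)) hR
      simpa using (this.const_mul C).mul_const |b - a|
    refine squeeze_zero_norm' ?_ h3
    filter_upwards [eventually_gt_atTop 0] with R hR
    refine norm_intervalIntegral_le_decay hC hR (γ := fun x => x + (R : ℂ) * I)
        (fun t ht => ?_) (fun t ht => ?_)
    · refine le_trans ?_ (abs_im_le_norm _)
      simp [abs_of_pos hR]
    · rw [uIoc_of_le hab] at ht
      refine hb _ (by simpa using ht.1.le) (by simpa using ht.2) (by simpa using hR.le) fun h => ?_
      have := congrArg Complex.im h
      simp at this; linarith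
  have h1 := (((tendsto_const_nhds (x := ∫ x in a..b, f x)).sub htop).add
    ((hlim b hab le_rfl).const_mul I)).sub ((hlim a le_rfl hab).const_mul I)
  rw [sub_zero] at h1
  refine tendsto_nhds_unique h1 (tendsto_const_nhds.congr' ?_)
  filter_upwards [eventually_gt_atTop 0] with R hR
  have h4 := Complex.integral_boundary_rect_eq_zero_of_continuousOn_of_differentiableOn f
      (⟨a, 0⟩ : ℂ) (⟨b, R⟩ : ℂ)
      (hc.mono fun z hz => by
        rw [mem_reProdIm, uIcc_of_le (by simpa using hab), uIcc_of_le (by simpa using hR.le)] at hz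
        exact ⟨hz.1.1, hz.1.2, hz.2.1⟩)
      (hd.mono fun z hz => by
        rw [mem_reProdIm] at hz
        simp only [min_eq_left hab, max_eq_right hab, min_eq_left hR.le, max_eq_right hR.le] at hz
        exact ⟨hz.1.1, hz.1.2, hz.2.1⟩)
  simp only [ofReal_zero, zero_mul, add_zero, smul_eq_mul] at h4
  exact h4.symm

/-- Cauchy's theorem on a half-strip, for integrands that decay at infinity and have at most an
inverse square root singularity at the boundary point `0`. -/
theorem integral_boundary_halfStrip_eq_zero {f : ℂ → ℂ} {a b C : ℝ} (hab : a ≤ b)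
    (hC : 0 ≤ C) (hc : ContinuousOn f ({z | a ≤ z.re ∧ z.re ≤ b ∧ 0 ≤ z.im} \ {0}))
    (hd : DifferentiableOn ℂ f {z | a < z.re ∧ z.re < b ∧ 0 < z.im})
    (hb : ∀ z : ℂ, a ≤ z.re → z.re ≤ b → 0 ≤ z.im → z ≠ 0 → ‖f z‖ ≤ C * decay ‖z‖) :
    (∫ x in a..b, f x) + I * (∫ y in Ioi (0 : ℝ), f (b + y * I)) -
      I * ∫ y in Ioi (0 : ℝ), f (a + y * I) = 0 := by
  -- The shift is now upward, by $i/(n+1)$, which again moves away from the singular point without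
  -- decreasing $|z|$.
  have hpos : ∀ n : ℕ, (0 : ℝ) < 1 / ((n : ℝ) + 1) := fun n => by positivity
  have him : ∀ (z : ℂ) (n : ℕ), 0 ≤ z.im → 0 < (z + ((1 / ((n : ℝ) + 1) : ℝ) : ℂ) * I).im := by
    intro z n hz
    rw [add_im, im_ofReal_mul, I_im, mul_one]
    linarith [hpos n]
  have hre : ∀ (z : ℂ) (n : ℕ), (z + ((1 / ((n : ℝ) + 1) : ℝ) : ℂ) * I).re = z.re := by
    intro z n
    rw [add_re, re_ofReal_mul, I_re, mul_zero, add_zero]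
  have hne : ∀ (z : ℂ) (n : ℕ), 0 ≤ z.im → z + ((1 / ((n : ℝ) + 1) : ℝ) : ℂ) * I ≠ 0 := by
    intro z n hz h
    have := him z n hz
    rw [h] at this; simp at this
  have hbn : ∀ (n : ℕ) (z : ℂ), a ≤ z.re → z.re ≤ b → 0 ≤ z.im → z ≠ 0 →
      ‖f (z + ((1 / ((n : ℝ) + 1) : ℝ) : ℂ) * I)‖ ≤ C * decay ‖z‖ := fun n z h1 h2 hz hz0 =>
    (hb _ ((hre z n).symm ▸ h1) ((hre z n).symm ▸ h2) (him z n hz).le (hne z n hz)).trans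
      (mul_le_mul_of_nonneg_left
      (decay_anti (norm_pos_iff.2 hz0) (norm_le_norm_add_real_mul_I hz (hpos n).le)) hC)
  have hcn : ∀ n : ℕ, ContinuousOn (fun z => f (z + ((1 / ((n : ℝ) + 1) : ℝ) : ℂ) * I))
      {z | a ≤ z.re ∧ z.re ≤ b ∧ 0 ≤ z.im} :=
    fun n => hc.comp (by fun_prop) fun z hz =>
      ⟨⟨(hre z n).symm ▸ hz.1, (hre z n).symm ▸ hz.2.1, (him z n hz.2.2).le⟩, hne z n hz.2.2⟩
  have h0 := fun n : ℕ => integral_boundary_halfStrip_eq_zero_of_continuousOn hab hC (hcn n)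
      (hd.comp (by fun_prop) fun z hz =>
        ⟨(hre z n).symm ▸ hz.1, (hre z n).symm ▸ hz.2.1, him z n hz.2.2.le⟩) (hbn n)
  have hcv : ∀ z : ℂ, a ≤ z.re → z.re ≤ b → 0 ≤ z.im → z ≠ 0 →
      Tendsto (fun n : ℕ => f (z + ((1 / ((n : ℝ) + 1) : ℝ) : ℂ) * I)) atTop (𝓝 (f z)) := by
    intro z h1 h2 h3 h4
    exact (hc z ⟨⟨h1, h2, h3⟩, h4⟩).tendsto.comp
        (tendsto_nhdsWithin_iff.2 ⟨tendsto_one_div_nat_add_one_complex I z,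
          Eventually.of_forall fun n =>
          ⟨⟨(hre z n).symm ▸ h1, (hre z n).symm ▸ h2, (him z n h3).le⟩, hne z n h3⟩⟩)
  have hvert : ∀ c : ℝ, a ≤ c → c ≤ b →
      Tendsto (fun n : ℕ => ∫ y in Ioi (0 : ℝ), f (c + y * I + ((1 / ((n : ℝ) + 1) : ℝ) : ℂ) * I))
        atTop (𝓝 (∫ y in Ioi (0 : ℝ), f (c + y * I))) := by
    intro c hac hcb
    have hz : ∀ y : ℝ, 0 < y → (c : ℂ) + y * I ≠ 0 := fun y hy h => by
      have := congrArg Complex.im h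
      simp at this; linarith
    refine tendsto_integral_of_dominated_convergence (fun y => C * decay y) (fun n => ?_)
      (integrableOn_decay.const_mul C) (fun n => ?_) ?_
    · refine ContinuousOn.aestronglyMeasurable ?_ measurableSet_Ioi
      exact (hcn n).comp (f := fun y : ℝ => (c : ℂ) + y * I) (by fun_prop)
        (fun y hy => by simpa using ⟨hac, hcb, le_of_lt hy⟩)
    · filter_upwards [ae_restrict_mem measurableSet_Ioi] with y hy
      refine (hbn n (c + y * I) (by simpa using hac) (by simpa using hcb)
        (by simpa using le_of_lt hy) (hz y hy)).trans
          (mul_le_mul_of_nonneg_left (decay_anti hy ?_) hC)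
      refine le_trans ?_ (abs_im_le_norm _)
      simpa using le_abs_self y
    · filter_upwards [ae_restrict_mem measurableSet_Ioi] with y hy
      exact hcv _ (by simpa using hac) (by simpa using hcb) (by simpa using le_of_lt hy) (hz y hy)
  have hhor : Tendsto (fun n : ℕ => ∫ x in a..b, f (x + ((1 / ((n : ℝ) + 1) : ℝ) : ℂ) * I))
        atTop (𝓝 (∫ x in a..b, f x)) := by
    have hae : ∀ᵐ y : ℝ, y ≠ 0 := by simp [ae_iff]
    refine intervalIntegral.tendsto_integral_filter_of_dominated_convergence
      (fun x => C * decay |x|) (Eventually.of_forall fun n => ?_)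
      (Eventually.of_forall fun n => ?_) (integrable_decay_abs.const_mul C).intervalIntegrable ?_
    · refine ContinuousOn.aestronglyMeasurable ?_ measurableSet_uIoc
      exact (hcn n).comp (f := fun x : ℝ => (x : ℂ)) (by fun_prop)
        (fun x hx => by rw [uIoc_of_le hab] at hx; simpa using ⟨hx.1.le, hx.2⟩)
    · filter_upwards [hae] with x hx0 hx
      rw [uIoc_of_le hab] at hx
      simpa using hbn n (x : ℂ) (by simpa using hx.1.le) (by simpa using hx.2) (by simp)
        (by simpa using hx0)
    · filter_upwards [hae] with x hx0 hx
      rw [uIoc_of_le hab] at hx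
      exact hcv (x : ℂ) (by simpa using hx.1.le) (by simpa using hx.2) (by simp)
        (by simpa using hx0)
  have h1 := (hhor.add ((hvert b hab le_rfl).const_mul I)).sub ((hvert a le_rfl hab).const_mul I)
  simp only [h0] at h1
  exact (tendsto_nhds_unique h1 tendsto_const_nhds)

end Contour

/-! ### Cauchy's integral formula for matrix functions. -/

section CauchyFormula

/-- Bounds of order $|z|^{-3/2}$ at infinity and $|z|^{-1/2}$ at $0$ are what `decay` encodes; the
part of `S` between the two regimes is compact and avoids $0$. -/
theorem exists_decay_bound {S : Set ℂ} (hS : IsClosed S) {f : ℂ → ℂ} (hc : ContinuousOn f (S \ {0}))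
    {R C₁ ρ C₂ : ℝ} (hρ : 0 < ρ)
    (hinf : ∀ z ∈ S, R ≤ ‖z‖ → ‖f z‖ ≤ C₁ * ((Real.sqrt ‖z‖)⁻¹ * ‖z‖⁻¹))
    (hzero : ∀ z ∈ S, z ≠ 0 → ‖z‖ ≤ ρ → ‖f z‖ ≤ C₂ * (Real.sqrt ‖z‖)⁻¹) :
    ∃ C : ℝ, 0 ≤ C ∧ ∀ z ∈ S, z ≠ 0 → ‖f z‖ ≤ C * decay ‖z‖ := by
  set R' := max R 1
  have hR' : 0 < R' := lt_of_lt_of_le one_pos (le_max_right _ _)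
  have hK : IsCompact (Metric.closedBall (0 : ℂ) R' ∩ (S ∩ {z | ρ ≤ ‖z‖})) :=
    (isCompact_closedBall _ _).inter_right
      (hS.inter (isClosed_le continuous_const continuous_norm))
  obtain ⟨C₃, hC₃⟩ := hK.exists_bound_of_continuousOn (f := f) (hc.mono fun z hz =>
    ⟨hz.2.1, norm_pos_iff.1 (hρ.trans_le hz.2.2)⟩)
  have hdR : 0 < decay R' := by
    unfold decay
    have := Real.sqrt_pos.2 hR'
    positivity
  refine ⟨2 * |C₁| + |C₂| * (1 + ρ) + |C₃| * (decay R')⁻¹, by positivity, fun z hz hz0 => ?_⟩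
  have hzp := norm_pos_iff.2 hz0
  have hsq := Real.sqrt_pos.2 hzp
  have hdz := decay_nonneg hzp.le
  have key : ∀ {A : ℝ}, ‖f z‖ ≤ A * decay ‖z‖ →
      A ≤ 2 * |C₁| + |C₂| * (1 + ρ) + |C₃| * (decay R')⁻¹ →
      ‖f z‖ ≤ (2 * |C₁| + |C₂| * (1 + ρ) + |C₃| * (decay R')⁻¹) * decay ‖z‖ :=
    fun h1 h2 => h1.trans (mul_le_mul_of_nonneg_right h2 hdz)
  have n1 : 0 ≤ 2 * |C₁| := by positivity
  have n2 : 0 ≤ |C₂| * (1 + ρ) := by positivity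
  have n3 : 0 ≤ |C₃| * (decay R')⁻¹ := by positivity
  by_cases h1 : R' ≤ ‖z‖
  · refine key (A := 2 * |C₁|) ?_ (by linarith)
    refine (hinf z hz ((le_max_left _ _).trans h1)).trans ?_
    have h2 : 1 ≤ ‖z‖ := (le_max_right _ _).trans h1
    have h3 : ‖z‖⁻¹ ≤ 2 * (1 + ‖z‖)⁻¹ := by
      rw [← div_eq_mul_inv, inv_eq_one_div, div_le_div_iff₀ hzp (by positivity)]
      linarith
    calc _ ≤ |C₁| * ((Real.sqrt ‖z‖)⁻¹ * (2 * (1 + ‖z‖)⁻¹)) := by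
          gcongr; exact le_abs_self _
      _ = _ := by unfold decay; ring
  by_cases h2 : ‖z‖ ≤ ρ
  · refine key (A := |C₂| * (1 + ρ)) ?_ (by linarith)
    refine (hzero z hz hz0 h2).trans ?_
    have h3 : 1 ≤ (1 + ρ) * (1 + ‖z‖)⁻¹ := by
      rw [← div_eq_mul_inv, one_le_div (by positivity)]
      linarith
    calc _ ≤ |C₂| * (Real.sqrt ‖z‖)⁻¹ := by gcongr; exact le_abs_self _
      _ ≤ |C₂| * (Real.sqrt ‖z‖)⁻¹ * ((1 + ρ) * (1 + ‖z‖)⁻¹) :=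
          le_mul_of_one_le_right (by positivity) h3
      _ = _ := by unfold decay; ring
  · push Not at h1 h2
    refine key (A := |C₃| * (decay R')⁻¹) ?_ (by linarith)
    have h3 := hC₃ z ⟨by simpa using h1.le, hz, h2.le⟩
    have h4 := decay_anti hzp h1.le
    calc _ ≤ |C₃| := h3.trans (le_abs_self _)
      _ = |C₃| * (decay R')⁻¹ * decay R' := by field_simp
      _ ≤ _ := by gcongr

theorem integrable_of_norm_le_decay {g : ℝ → ℂ} {C : ℝ} (hc : ContinuousOn g {0}ᶜ)
    (hb : ∀ y : ℝ, y ≠ 0 → ‖g y‖ ≤ C * decay |y|) : Integrable g := by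
  have hr : volume.restrict ({0}ᶜ : Set ℝ) = volume :=
    Measure.restrict_eq_self_of_ae_mem (by simp [ae_iff])
  have hm : AEStronglyMeasurable g volume := by
    rw [← hr]
    exact hc.aestronglyMeasurable (measurableSet_singleton 0).compl
  refine (integrable_decay_abs.const_mul C).mono' hm ?_
  have : ∀ᵐ y : ℝ, y ≠ 0 := by simp [ae_iff]
  filter_upwards [this] with y hy using hb y hy

variable {ι : Type*} [Fintype ι] [DecidableEq ι]

theorem differentiableAt_resolvent {B : Matrix ι ι ℂ} {z : ℂ}
    (hz : IsUnit (z • (1 : Matrix ι ι ℂ) - B)) (i j : ι) :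
    DifferentiableAt ℂ (fun w : ℂ => (w • (1 : Matrix ι ι ℂ) - B)⁻¹ i j) z := by
  refine differentiableAt_inv_entry (fun i j => ?_) hz i j
  simp only [Matrix.sub_apply, Matrix.smul_apply, smul_eq_mul]
  fun_prop

/-- A resolvent is only $O(1/|z|)$, hence not absolutely integrable along a line; subtracting a
scalar resolvent cancels the leading term, by the resolvent identity. -/
theorem exists_resolvent_sub_bound (B : Matrix ι ι ℂ) (c : ℂ) :
    ∃ R C : ℝ, 0 < R ∧ 0 ≤ C ∧ ∀ z : ℂ, R ≤ ‖z‖ → ∀ i j,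
      ‖(z • (1 : Matrix ι ι ℂ) - B)⁻¹ i j - (z - c)⁻¹ * (1 : Matrix ι ι ℂ) i j‖ ≤
        C * (‖z‖⁻¹ * ‖z‖⁻¹) := by
  obtain ⟨R, C, hR, hC, h⟩ := exists_resolvent_bound B
  set D := ∑ k, ∑ l, ‖(B - c • (1 : Matrix ι ι ℂ)) k l‖ with hD
  have hD0 : 0 ≤ D := by positivity
  -- Beyond $2|c|$ one has $|z-c|\ge|z|/2$, the source of the factor $2$.
  refine ⟨max R (2 * ‖c‖), C * D * 2, lt_max_of_lt_left hR, by positivity, fun z hz i j => ?_⟩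
  obtain ⟨hu, hb⟩ := h z ((le_max_left _ _).trans hz)
  have hzp : 0 < ‖z‖ := hR.trans_le ((le_max_left _ _).trans hz)
  have hzc : ‖z‖ / 2 ≤ ‖z - c‖ := by
    have h1 := norm_sub_norm_le z c
    have h2 := (le_max_right _ _).trans hz
    linarith
  have hzc0 : z - c ≠ 0 := norm_pos_iff.1 (by linarith)
  have e : (z • (1 : Matrix ι ι ℂ) - B)⁻¹ - (z - c)⁻¹ • (1 : Matrix ι ι ℂ) =
      (z - c)⁻¹ • ((z • (1 : Matrix ι ι ℂ) - B)⁻¹ * (B - c • (1 : Matrix ι ι ℂ))) := by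
    have h1 : B - c • (1 : Matrix ι ι ℂ) = (z - c) • (1 : Matrix ι ι ℂ) -
        (z • (1 : Matrix ι ι ℂ) - B) := by module
    rw [h1, mul_sub, Matrix.nonsing_inv_mul _ ((Matrix.isUnit_iff_isUnit_det _).1 hu),
      mul_smul_comm, mul_one, smul_sub, smul_smul, inv_mul_cancel₀ hzc0, one_smul]
  have e' := congrFun (congrFun e i) j
  rw [Matrix.sub_apply, Matrix.smul_apply, Matrix.smul_apply, smul_eq_mul, smul_eq_mul] at e'
  rw [e', norm_mul, norm_inv, Matrix.mul_apply]
  have h2 : ‖∑ k, (z • (1 : Matrix ι ι ℂ) - B)⁻¹ i k * (B - c • (1 : Matrix ι ι ℂ)) k j‖ ≤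
      C * ‖z‖⁻¹ * D := by
    rw [hD, Finset.mul_sum]
    refine norm_sum_le_of_le _ fun k _ => ?_
    rw [norm_mul]
    gcongr
    · exact hb i k
    · exact Finset.single_le_sum (f := fun l => ‖(B - c • (1 : Matrix ι ι ℂ)) k l‖)
        (fun _ _ => norm_nonneg _) (Finset.mem_univ j)
  have h3 : ‖z - c‖⁻¹ ≤ 2 * ‖z‖⁻¹ := by
    rw [← div_eq_mul_inv, ← inv_div]
    gcongr
  calc _ ≤ 2 * ‖z‖⁻¹ * (C * ‖z‖⁻¹ * D) := by gcongr
    _ = _ := by ring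

theorem inv_mul_inv_le_sqrt {t : ℝ} (ht : 1 ≤ t) : t⁻¹ * t⁻¹ ≤ (Real.sqrt t)⁻¹ * t⁻¹ := by
  have h1 : 0 < Real.sqrt t := Real.sqrt_pos.2 (by linarith)
  have h2 : Real.sqrt t ≤ t := by
    rw [Real.sqrt_le_left (by linarith)]; nlinarith
  gcongr

theorem one_le_inv_sqrt {t : ℝ} (ht0 : 0 < t) (ht : t ≤ 1) : 1 ≤ (Real.sqrt t)⁻¹ :=
  (one_le_inv₀ (Real.sqrt_pos.2 ht0)).2 (Real.sqrt_le_one.2 ht)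

theorem mul_I_sub_ofReal_ne_zero {y c : ℝ} (hc : c ≠ 0) : (y : ℂ) * I - c ≠ 0 := by
  intro h
  have := congrArg Complex.re h
  simp at this
  exact hc this

/-- The spectrum of $B$ and the pole $1$ both lie to the right, so the difference is holomorphic on
the left half-plane; the reflection $z\mapsto-z$ brings it to the right one. -/
theorem integral_imaginaryAxis_resolvent_sub {B : Matrix ι ι ℂ}
    (hB : ∀ z : ℂ, z.re ≤ 0 → IsUnit (z • (1 : Matrix ι ι ℂ) - B)) (i j : ι) :
    Integrable (fun y : ℝ => ((y * I : ℂ) • (1 : Matrix ι ι ℂ) - B)⁻¹ i j -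
      ((y : ℂ) * I - (1 : ℝ))⁻¹ * (1 : Matrix ι ι ℂ) i j) ∧
    ∫ y : ℝ, (((y * I : ℂ) • (1 : Matrix ι ι ℂ) - B)⁻¹ i j -
      ((y : ℂ) * I - (1 : ℝ))⁻¹ * (1 : Matrix ι ι ℂ) i j) = 0 := by
  set g : ℂ → ℂ := fun z => ((-z) • (1 : Matrix ι ι ℂ) - B)⁻¹ i j -
    (-z - (1 : ℝ))⁻¹ * (1 : Matrix ι ι ℂ) i j with hg
  have hgd : ∀ z : ℂ, 0 ≤ z.re → DifferentiableAt ℂ g z := by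
    intro z hz
    have h1 : -z - ((1 : ℝ) : ℂ) ≠ 0 := by
      intro h
      have := congrArg Complex.re h
      simp at this; linarith
    have h2 : DifferentiableAt ℂ (fun w : ℂ => (-w - ((1 : ℝ) : ℂ))⁻¹) z := by
      fun_prop (disch := exact h1)
    refine DifferentiableAt.sub ?_ (h2.mul_const _)
    exact (differentiableAt_resolvent (B := B) (z := -z) (hB _ (by simpa using hz)) i j).comp z
      differentiableAt_id.neg
  obtain ⟨R, C₁, hR, hC₁, hinf⟩ := exists_resolvent_sub_bound B ((1 : ℝ) : ℂ)
  have hSc : IsClosed {z : ℂ | 0 ≤ z.re} := isClosed_le continuous_const continuous_re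
  have hgc : ContinuousOn g {z : ℂ | 0 ≤ z.re} := fun z hz =>
    (hgd z hz).continuousAt.continuousWithinAt
  obtain ⟨C₂, hC₂⟩ := ((isCompact_closedBall (0 : ℂ) 1).inter_right
    hSc).exists_bound_of_continuousOn (hgc.mono inter_subset_right)
  obtain ⟨C, hC, hb⟩ := exists_decay_bound (S := {z : ℂ | 0 ≤ z.re}) (f := g) hSc
    (hgc.mono sdiff_subset) (R := max R 1) (C₁ := C₁) (ρ := 1) (C₂ := |C₂|) one_pos
    (fun z hz hzR => by
      have h1 := hinf (-z) (by rw [norm_neg]; exact (le_max_left _ _).trans hzR) i j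
      rw [norm_neg] at h1
      exact h1.trans (mul_le_mul_of_nonneg_left
        (inv_mul_inv_le_sqrt ((le_max_right _ _).trans hzR)) hC₁))
    (fun z hz hz0 hz1 => by
      refine (hC₂ z ⟨by simpa using hz1, hz⟩).trans ((le_abs_self _).trans ?_)
      exact le_mul_of_one_le_right (abs_nonneg _) (one_le_inv_sqrt (norm_pos_iff.2 hz0) hz1))
  have hval := integral_imaginaryAxis_eq_zero hC (hgc.mono sdiff_subset)
    (fun z hz => (hgd z (le_of_lt hz)).differentiableWithinAt) hb
  have heq : ∀ y : ℝ, ((y * I : ℂ) • (1 : Matrix ι ι ℂ) - B)⁻¹ i j -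
      ((y : ℂ) * I - (1 : ℝ))⁻¹ * (1 : Matrix ι ι ℂ) i j = g (((-y : ℝ) : ℂ) * I) := by
    intro y
    simp [hg]
  constructor
  · simp only [heq]
    refine Integrable.comp_neg (f := fun y : ℝ => g (y * I)) ?_
    refine integrable_of_norm_le_decay (C := C) ?_ fun y hy => ?_
    · exact hgc.comp (by fun_prop) fun y _ => by simp
    · simpa using hb (y * I) (by simp) (by simpa using hy)
  · simp only [heq]
    rw [integral_neg_eq_self (fun y : ℝ => g (y * I)) volume]
    exact hval

theorem integral_inv_mul_I_sub :
    Integrable (fun y : ℝ => ((y : ℂ) * I - (1 : ℝ))⁻¹ - ((y : ℂ) * I - (-1 : ℝ))⁻¹) ∧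
    ∫ y : ℝ, (((y : ℂ) * I - (1 : ℝ))⁻¹ - ((y : ℂ) * I - (-1 : ℝ))⁻¹) = -(2 * Real.pi) := by
  have h : ∀ y : ℝ, ((y : ℂ) * I - (1 : ℝ))⁻¹ - ((y : ℂ) * I - (-1 : ℝ))⁻¹ =
      -2 * (((1 + y ^ 2)⁻¹ : ℝ) : ℂ) := by
    intro y
    have h1 := mul_I_sub_ofReal_ne_zero (y := y) (c := 1) one_ne_zero
    have h2 := mul_I_sub_ofReal_ne_zero (y := y) (c := -1) (by norm_num)
    have h3 : (1 : ℂ) + (y : ℂ) ^ 2 ≠ 0 := by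
      have : (1 + y ^ 2 : ℝ) ≠ 0 := by positivity
      exact_mod_cast this
    push_cast at h1 h2 ⊢
    field_simp
    ring_nf
    simp only [I_sq]
    ring
  constructor
  · simp only [h]
    exact (integrable_inv_one_add_sq.ofReal).const_mul _
  · simp only [h]
    rw [integral_const_mul, integral_complex_ofReal, integral_univ_inv_one_add_sq]
    ring

/-- Moving the pole of the correction from $1$ to $-1$ costs $-2\pi$ times the identity. The
correction is then holomorphic on the right half-plane, as the Cauchy formula requires. -/
theorem integral_imaginaryAxis_resolvent_add {B : Matrix ι ι ℂ}
    (hB : ∀ z : ℂ, z.re ≤ 0 → IsUnit (z • (1 : Matrix ι ι ℂ) - B)) (i j : ι) :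
    Integrable (fun y : ℝ => ((y * I : ℂ) • (1 : Matrix ι ι ℂ) - B)⁻¹ i j -
      ((y : ℂ) * I - (-1 : ℝ))⁻¹ * (1 : Matrix ι ι ℂ) i j) ∧
    ∫ y : ℝ, (((y * I : ℂ) • (1 : Matrix ι ι ℂ) - B)⁻¹ i j -
      ((y : ℂ) * I - (-1 : ℝ))⁻¹ * (1 : Matrix ι ι ℂ) i j) =
      -(2 * Real.pi) * (1 : Matrix ι ι ℂ) i j := by
  obtain ⟨h1, h2⟩ := integral_imaginaryAxis_resolvent_sub hB i j
  obtain ⟨h3, h4⟩ := integral_inv_mul_I_sub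
  have h5 := h3.mul_const ((1 : Matrix ι ι ℂ) i j)
  have e : ∀ y : ℝ, ((y * I : ℂ) • (1 : Matrix ι ι ℂ) - B)⁻¹ i j -
      ((y : ℂ) * I - (-1 : ℝ))⁻¹ * (1 : Matrix ι ι ℂ) i j =
      (((y * I : ℂ) • (1 : Matrix ι ι ℂ) - B)⁻¹ i j -
      ((y : ℂ) * I - (1 : ℝ))⁻¹ * (1 : Matrix ι ι ℂ) i j) +
      (((y : ℂ) * I - (1 : ℝ))⁻¹ - ((y : ℂ) * I - (-1 : ℝ))⁻¹) * (1 : Matrix ι ι ℂ) i j :=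
    fun y => by ring
  simp only [e]
  refine ⟨h1.add h5, ?_⟩
  rw [integral_add h1 h5, h2, integral_mul_const, h4, zero_add]

/-- Cauchy's integral formula for a matrix function, over the imaginary axis. -/
theorem matrixFunction_apply_eq_integral {f : ℂ → ℂ} (hf : DifferentiableOn ℂ f slitPlane) {c : ℝ}
    (hfb : ∀ z : ℂ, 0 ≤ z.re → z ≠ 0 → ‖f z‖ ≤ c * (Real.sqrt ‖z‖)⁻¹) {B : Matrix ι ι ℂ}
    (hB : ∀ z : ℂ, z.re ≤ 0 → IsUnit (z • (1 : Matrix ι ι ℂ) - B)) (i j : ι) :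
    ∫ y : ℝ, f (y * I) * ((y * I : ℂ) • (1 : Matrix ι ι ℂ) - B)⁻¹ i j =
      -(2 * Real.pi) * matrixFunction f B i j := by
  have hc0 : 0 ≤ c := by
    have := hfb 1 (by simp) one_ne_zero
    simp at this
    exact (norm_nonneg _).trans this
  have hslit : ∀ z : ℂ, 0 ≤ z.re → z ≠ 0 → z ∈ slitPlane := by
    intro z hz hz0
    rw [mem_slitPlane_iff]
    by_contra! h
    exact hz0 (Complex.ext (le_antisymm h.1 hz) h.2)
  obtain ⟨H, hHd, hH⟩ := exists_differentiableOn_sub_matrixFunction_mul_inv isOpen_slitPlane hf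
    (B := B) fun a ha => hB a (by
      rw [mem_slitPlane_iff] at ha
      push Not at ha
      exact ha.1)
  set F := matrixFunction f B
  set T : ℂ → Matrix ι ι ℂ := fun z => (z • (1 : Matrix ι ι ℂ) - B)⁻¹ with hT
  -- `H` extends $(f(z)-f(B))(z-B)^{-1}$ across the spectrum. Adding $f(B)/(z+1)$ cancels the
  -- leading term of $f(B)(z-B)^{-1}$ at infinity, so `g` decays like $|z|^{-3/2}$ and its integral
  -- vanishes.
  set g : ℂ → ℂ := fun z => H z i j + (z - (-1 : ℝ))⁻¹ * F i j with hg
  have hgd : DifferentiableOn ℂ g ({z | 0 ≤ z.re} \ {0}) := by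
    refine ((hHd i j).mono fun z hz => hslit z hz.1 hz.2).add fun z hz => ?_
    have h1 : z - ((-1 : ℝ) : ℂ) ≠ 0 := by
      intro h
      have h2 := congrArg Complex.re h
      have h3 : 0 ≤ z.re := hz.1
      simp at h2; linarith
    have h4 : DifferentiableAt ℂ (fun w : ℂ => (w - ((-1 : ℝ) : ℂ))⁻¹) z := by
      fun_prop (disch := exact h1)
    exact (h4.mul_const _).differentiableWithinAt
  have hgeq : ∀ z : ℂ, z ∈ slitPlane → IsUnit (z • (1 : Matrix ι ι ℂ) - B) →
      g z = f z * T z i j - ∑ k, F i k * (T z k j - (z - (-1 : ℝ))⁻¹ * (1 : Matrix ι ι ℂ) k j) := by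
    intro z hz hu
    have h1 : ∑ k, F i k * ((z - (-1 : ℝ))⁻¹ * (1 : Matrix ι ι ℂ) k j) = (z - (-1 : ℝ))⁻¹ * F i j := by
      rw [Finset.sum_eq_single j (fun k _ hk => by simp [hk]) (by simp)]
      rw [Matrix.one_apply_eq]; ring
    simp only [hg]
    rw [hH z hz hu, sub_mul, smul_mul_assoc, one_mul, Matrix.sub_apply, Matrix.smul_apply,
      Matrix.mul_apply, smul_eq_mul]
    simp only [mul_sub, Finset.sum_sub_distrib, h1]
    ring
  -- The same identity grouped for use near $0$, where everything after the first product is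
  -- continuous.
  have hgt : ∀ z : ℂ, z ∈ slitPlane → IsUnit (z • (1 : Matrix ι ι ℂ) - B) →
      g z = f z * T z i j - ((∑ k, F i k * T z k j) - (z - (-1 : ℝ))⁻¹ * F i j) := by
    intro z hz hu
    simp only [hg]
    rw [hH z hz hu, sub_mul, smul_mul_assoc, one_mul, Matrix.sub_apply, Matrix.smul_apply,
      Matrix.mul_apply, smul_eq_mul]
    ring
  obtain ⟨R₁, C₁, hR₁, hC₁, hres⟩ := exists_resolvent_bound B
  obtain ⟨R₂, C₂, hR₂, hC₂, hres₂⟩ := exists_resolvent_sub_bound B ((-1 : ℝ) : ℂ)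
  have hu0 := hB 0 (by simp)
  have hT0 : ∀ k l, ContinuousAt (fun z => T z k l) 0 := fun k l =>
    (differentiableAt_resolvent hu0 k l).continuousAt
  have hS0 : ContinuousAt (fun z => (∑ k, F i k * T z k j) - (z - (-1 : ℝ))⁻¹ * F i j) 0 := by
    refine ContinuousAt.sub ?_ (ContinuousAt.mul_const (ContinuousAt.inv₀ (by fun_prop) (by simp)) _)
    exact tendsto_finsetSum _ fun k _ => (hT0 k j).const_mul _
  have hunit0 : ∀ᶠ z in 𝓝 (0 : ℂ), IsUnit (z • (1 : Matrix ι ι ℂ) - B) := by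
    have hd : DifferentiableAt ℂ (fun z : ℂ => (z • (1 : Matrix ι ι ℂ) - B).det) 0 :=
      differentiableAt_det fun k l => by
        simp only [Matrix.sub_apply, Matrix.smul_apply, smul_eq_mul]
        fun_prop
    have := hd.continuousAt.eventually_ne ((Matrix.isUnit_iff_isUnit_det _).1 hu0).ne_zero
    filter_upwards [this] with w hw
    exact (Matrix.isUnit_iff_isUnit_det _).2 (isUnit_iff_ne_zero.2 hw)
  obtain ⟨δ, hδ, hnear⟩ := Metric.eventually_nhds_iff.1 (hunit0.and
    (((hT0 i j).norm.eventually_lt_const (lt_add_one _)).and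
      (hS0.norm.eventually_lt_const (lt_add_one _))))
  set c₁ := ‖T 0 i j‖ + 1
  set c₂ := ‖(∑ k, F i k * T 0 k j) - (0 - ((-1 : ℝ) : ℂ))⁻¹ * F i j‖ + 1
  have hc₁ : 0 ≤ c₁ := by positivity
  have hc₂ : 0 ≤ c₂ := by positivity
  obtain ⟨C, hC, hb⟩ := exists_decay_bound (S := {z : ℂ | 0 ≤ z.re}) (f := g)
    (isClosed_le continuous_const continuous_re) hgd.continuousOn
    (R := max (max R₁ R₂) 1) (C₁ := c * C₁ + ∑ k, ‖F i k‖ * C₂) (ρ := min (δ / 2) 1)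
    (C₂ := c * c₁ + c₂) (by positivity)
    (fun z hz hzR => by
      have hz1 : R₁ ≤ ‖z‖ := (le_max_left _ _).trans ((le_max_left _ _).trans hzR)
      have hz2 : R₂ ≤ ‖z‖ := (le_max_right _ _).trans ((le_max_left _ _).trans hzR)
      have hz3 : 1 ≤ ‖z‖ := (le_max_right _ _).trans hzR
      have hz0 : z ≠ 0 := norm_pos_iff.1 (by linarith)
      obtain ⟨hu, hTb⟩ := hres z hz1
      rw [hgeq z (hslit z hz hz0) hu, add_mul, Finset.sum_mul]
      refine (norm_sub_le _ _).trans (add_le_add ?_ (norm_sum_le_of_le _ fun k _ => ?_))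
      · rw [norm_mul]
        calc _ ≤ (c * (Real.sqrt ‖z‖)⁻¹) * (C₁ * ‖z‖⁻¹) :=
              mul_le_mul (hfb z hz hz0) (hTb i j) (norm_nonneg _) (by positivity)
          _ = _ := by ring
      · rw [norm_mul, mul_assoc]
        refine mul_le_mul_of_nonneg_left ((hres₂ z hz2 k j).trans ?_) (norm_nonneg _)
        exact mul_le_mul_of_nonneg_left (inv_mul_inv_le_sqrt hz3) hC₂)
    (fun z hz hz0 hz1 => by
      have hzp := norm_pos_iff.2 hz0
      obtain ⟨hu, hb1, hb2⟩ := hnear (y := z) (by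
        rw [dist_zero_right]
        exact (hz1.trans (min_le_left _ _)).trans_lt (by linarith))
      rw [hgt z (hslit z hz hz0) hu, add_mul]
      refine (norm_sub_le _ _).trans (add_le_add ?_ ?_)
      · rw [norm_mul]
        calc _ ≤ (c * (Real.sqrt ‖z‖)⁻¹) * c₁ :=
              mul_le_mul (hfb z hz hz0) hb1.le (norm_nonneg _) (by positivity)
          _ = _ := by ring
      · exact hb2.le.trans (le_mul_of_one_le_right hc₂
          (one_le_inv_sqrt hzp (hz1.trans (min_le_right _ _)))))
  have hval := integral_imaginaryAxis_eq_zero hC hgd.continuousOn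
    (hgd.mono fun z (hz : 0 < z.re) => ⟨hz.le, by rintro rfl; simp at hz⟩) hb
  have hgi : Integrable fun y : ℝ => g (y * I) := by
    refine integrable_of_norm_le_decay (C := C) ?_ fun y hy => ?_
    · refine hgd.continuousOn.comp (by fun_prop) fun y hy => ⟨by simp, by simpa using hy⟩
    · simpa using hb (y * I) (by simp) (by simpa using hy)
  have hsi : ∀ k ∈ Finset.univ, Integrable fun y : ℝ => F i k * (T (y * I) k j -
      ((y : ℂ) * I - (-1 : ℝ))⁻¹ * (1 : Matrix ι ι ℂ) k j) := fun k _ =>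
    (integral_imaginaryAxis_resolvent_add hB k j).1.const_mul _
  have hae : ∀ᵐ y : ℝ, f (y * I) * T (y * I) i j = g (y * I) + ∑ k, F i k * (T (y * I) k j -
      ((y : ℂ) * I - (-1 : ℝ))⁻¹ * (1 : Matrix ι ι ℂ) k j) := by
    have : ∀ᵐ y : ℝ, y ≠ 0 := by simp [ae_iff]
    filter_upwards [this] with y hy
    rw [hgeq _ (hslit _ (by simp) (by simpa using hy)) (hB _ (by simp))]
    ring
  rw [integral_congr_ae hae, integral_add hgi (integrable_finsetSum _ hsi), hval,
    integral_finsetSum _ hsi, zero_add]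
  simp only [integral_const_mul, hT, (integral_imaginaryAxis_resolvent_add hB _ j).2]
  rw [Finset.sum_eq_single j (fun k _ hk => by simp [hk]) (by simp)]
  rw [Matrix.one_apply_eq]; ring

end CauchyFormula

/-! ### Branches of $\sqrt{z/i}$, bounds for the kernel and its jump. -/

section Transfer

/-- The transfer operator as a function of the square root. -/
def kernelOfSqrt (d : ℝ) (w : ℂ) : ℂ := 1 / (2 * w) * Complex.exp (-(d : ℂ) * w)

theorem differentiableAt_kernelOfSqrt (d : ℝ) {w : ℂ} (hw : w ≠ 0) :
    DifferentiableAt ℂ (kernelOfSqrt d) w := by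
  unfold kernelOfSqrt
  have : 2 * w ≠ 0 := mul_ne_zero two_ne_zero hw
  fun_prop (disch := exact this)

theorem norm_eq_sqrt_of_sq_eq {w z : ℂ} (hw : w ^ 2 = -I * z) : ‖w‖ = Real.sqrt ‖z‖ := by
  have h := congrArg norm hw
  rw [norm_pow, norm_mul, norm_neg, norm_I, one_mul] at h
  rw [← h, Real.sqrt_sq (norm_nonneg _)]

/-- Here $2\,\Re w\,\Im w=-\Re z\le\xi$. If $\Im w\le\Re w<0$, then $(\Re w)^2\le\Re w\,\Im
w\le\xi/2$. This is the origin of $\sqrt{\xi/2}$ in the final exponent. -/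
theorem neg_sqrt_le_re_of_sq_eq {w z : ℂ} (hw : w ^ 2 = -I * z) (hwi : w.im ≤ w.re) {ξ : ℝ}
    (hz : -ξ ≤ z.re) : -Real.sqrt (ξ / 2) ≤ w.re := by
  have h := congrArg Complex.im hw
  simp only [sq, mul_im, neg_re, I_re, neg_im, I_im] at h
  by_contra! h1
  have h2 : 0 ≤ Real.sqrt (ξ / 2) := Real.sqrt_nonneg _
  have h3 : Real.sqrt (ξ / 2) < -w.re := by linarith
  rw [Real.sqrt_lt' (by linarith)] at h3
  nlinarith

theorem norm_kernelOfSqrt_le {d : ℝ} (hd : 0 ≤ d) {w z : ℂ} (hw : w ^ 2 = -I * z)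
    (hwi : w.im ≤ w.re) {ξ : ℝ} (hz : -ξ ≤ z.re) :
    ‖kernelOfSqrt d w‖ ≤ Real.exp (d * Real.sqrt (ξ / 2)) / 2 * (Real.sqrt ‖z‖)⁻¹ := by
  unfold kernelOfSqrt
  rw [norm_mul, norm_div, norm_one, norm_mul, norm_eq_sqrt_of_sq_eq hw, Complex.norm_exp]
  have h1 : (-(d : ℂ) * w).re ≤ d * Real.sqrt (ξ / 2) := by
    rw [neg_mul, neg_re, re_ofReal_mul]
    nlinarith [neg_sqrt_le_re_of_sq_eq hw hwi hz]
  calc _ ≤ 1 / (‖(2 : ℂ)‖ * Real.sqrt ‖z‖) * Real.exp (d * Real.sqrt (ξ / 2)) := by gcongr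
    _ = _ := by
      rw [Complex.norm_ofNat, one_div, mul_inv]; ring

theorem cpow_half_sq (z : ℂ) : (z ^ (1 / 2 : ℂ)) ^ 2 = z := by
  rw [one_div]
  exact_mod_cast Complex.cpow_nat_inv_pow z two_ne_zero

theorem cpow_half_eq_of_sq_eq {v z : ℂ} (hv : v ^ 2 = z) (hre : 0 < v.re) :
    z ^ (1 / 2 : ℂ) = v := by
  rw [← hv, one_div, Complex.sq_cpow_two_inv hre]

theorem re_cpow_half_nonneg (z : ℂ) : 0 ≤ (z ^ (1 / 2 : ℂ)).re := by
  by_cases hz : z = 0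
  · simp [hz]
  rw [cpow_def_of_ne_zero hz, exp_re]
  refine mul_nonneg (Real.exp_pos _).le (Real.cos_nonneg_of_mem_Icc ?_)
  have h : (log z * (1 / 2)).im = arg z / 2 := by
    rw [← log_im]; simp [div_eq_mul_inv]
  rw [h]
  constructor <;> linarith [neg_pi_lt_arg z, arg_le_pi z]

theorem sqrtDivI_sq (z : ℂ) : sqrtDivI z ^ 2 = -I * z := by
  unfold sqrtDivI
  rw [mul_pow, cpow_half_sq, ← Complex.exp_nat_mul]
  congr 1
  have : ((2 : ℕ) : ℂ) * -(I * Real.pi / 4) = -(Real.pi / 2 * I) := by push_cast; ring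
  rw [this, Complex.exp_neg, Complex.exp_pi_div_two_mul_I, inv_I]

theorem sqrtDivI_eq_exp {z : ℂ} (hz : z ≠ 0) :
    sqrtDivI z = Complex.exp ((Real.log ‖z‖ / 2 : ℝ) + (arg z / 2 - Real.pi / 4 : ℝ) * I) := by
  unfold sqrtDivI
  rw [cpow_def_of_ne_zero hz, ← Complex.exp_add]
  congr 1
  rw [Complex.log]
  push_cast
  ring

theorem sqrtDivI_re {z : ℂ} (hz : z ≠ 0) :
    (sqrtDivI z).re = Real.exp (Real.log ‖z‖ / 2) * Real.cos (arg z / 2 - Real.pi / 4) := by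
  rw [sqrtDivI_eq_exp hz, exp_re]
  simp

theorem sqrtDivI_im {z : ℂ} (hz : z ≠ 0) :
    (sqrtDivI z).im = Real.exp (Real.log ‖z‖ / 2) * Real.sin (arg z / 2 - Real.pi / 4) := by
  rw [sqrtDivI_eq_exp hz, exp_im]
  simp

/-- The argument of $\sqrt{z/i}$ lies in $(-3\pi/4,\pi/4]$, which is contained in this closed
half-plane. -/
theorem sqrtDivI_im_le_re (z : ℂ) : (sqrtDivI z).im ≤ (sqrtDivI z).re := by
  by_cases hz : z = 0
  · simp [hz, sqrtDivI]
  rw [sqrtDivI_re hz, sqrtDivI_im hz]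
  refine mul_le_mul_of_nonneg_left ?_ (Real.exp_pos _).le
  rw [Real.sin_sub, Real.cos_sub, Real.cos_pi_div_four, Real.sin_pi_div_four]
  have h1 : 0 ≤ Real.cos (arg z / 2) := Real.cos_nonneg_of_mem_Icc
    ⟨by linarith [neg_pi_lt_arg z], by linarith [arg_le_pi z]⟩
  have h2 : 0 < Real.sqrt 2 := by positivity
  nlinarith

/-- The branch of `√(z/i)` that is continuous on the closed upper half-plane. -/
def sqrtUpper (z : ℂ) : ℂ := (-I * z) ^ (1 / 2 : ℂ)

/-- The branch of `√(z/i)` that is continuous on the closed lower half-plane. -/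
def sqrtLower (z : ℂ) : ℂ := -I * (I * z) ^ (1 / 2 : ℂ)

theorem sqrtUpper_sq (z : ℂ) : sqrtUpper z ^ 2 = -I * z := cpow_half_sq _

theorem sqrtLower_sq (z : ℂ) : sqrtLower z ^ 2 = -I * z := by
  unfold sqrtLower
  rw [mul_pow, cpow_half_sq, neg_sq, I_sq]; ring

theorem sqrtDivI_eq_sqrtUpper {z : ℂ} (hz : z ≠ 0) (him : 0 ≤ z.im) :
    sqrtDivI z = sqrtUpper z := by
  refine (cpow_half_eq_of_sq_eq (sqrtDivI_sq z) ?_).symm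
  rw [sqrtDivI_re hz]
  refine mul_pos (Real.exp_pos _) (Real.cos_pos_of_mem_Ioo ?_)
  have h1 := arg_nonneg_iff.2 him
  constructor <;> linarith [arg_le_pi z, Real.pi_pos]

theorem sqrtDivI_eq_sqrtLower {z : ℂ} (him : z.im < 0) : sqrtDivI z = sqrtLower z := by
  have hz : z ≠ 0 := by rintro rfl; simp at him
  have h : (I * z) ^ (1 / 2 : ℂ) = I * sqrtDivI z := by
    refine cpow_half_eq_of_sq_eq (by rw [mul_pow, sqrtDivI_sq, I_sq]; ring) ?_
    rw [I_mul_re, sqrtDivI_im hz, neg_pos]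
    refine mul_neg_of_pos_of_neg (Real.exp_pos _) (Real.sin_neg_of_neg_of_neg_pi_lt ?_ ?_)
    · linarith [arg_neg_iff.2 him, Real.pi_pos]
    · linarith [neg_pi_lt_arg z, Real.pi_pos]
  rw [sqrtLower, h, ← mul_assoc, neg_mul, I_mul_I]; ring

theorem sqrtLower_im_le_re {z : ℂ} (him : z.im ≤ 0) : (sqrtLower z).im ≤ (sqrtLower z).re := by
  unfold sqrtLower
  have h1 := re_cpow_half_nonneg (I * z)
  have h2 := congrArg Complex.re (cpow_half_sq (I * z))
  rw [sq, mul_re, I_mul_re] at h2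
  set u := (I * z) ^ (1 / 2 : ℂ)
  simp only [mul_im, mul_re, neg_re, I_re, neg_im, I_im]
  by_contra! h3
  nlinarith

theorem ne_zero_of_sq_eq {w z : ℂ} (hw : w ^ 2 = -I * z) (hz : z ≠ 0) : w ≠ 0 := by
  rintro rfl
  rw [zero_pow two_ne_zero] at hw
  exact mul_ne_zero (neg_ne_zero.2 I_ne_zero) hz hw.symm

theorem differentiableAt_sqrtDivI {z : ℂ} (hz : z ∈ slitPlane) :
    DifferentiableAt ℂ sqrtDivI z := by
  unfold sqrtDivI
  exact (differentiableAt_id.cpow_const hz).const_mul _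

theorem differentiableAt_sqrtUpper {z : ℂ} (hz : z ≠ 0) (him : 0 ≤ z.im) :
    DifferentiableAt ℂ sqrtUpper z := by
  unfold sqrtUpper
  refine DifferentiableAt.cpow_const (by fun_prop) ?_
  rw [mem_slitPlane_iff]
  by_contra! h
  simp only [neg_mul, neg_re, I_mul_re, neg_neg, neg_im, I_mul_im, neg_eq_zero] at h
  exact hz (Complex.ext h.2 (le_antisymm h.1 him))

theorem differentiableAt_sqrtLower {z : ℂ} (hz : z ≠ 0) (him : z.im ≤ 0) :
    DifferentiableAt ℂ sqrtLower z := by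
  unfold sqrtLower
  refine DifferentiableAt.const_mul (DifferentiableAt.cpow_const (by fun_prop) ?_) _
  rw [mem_slitPlane_iff]
  by_contra! h
  simp only [I_mul_re, I_mul_im] at h
  exact hz (Complex.ext h.2 (le_antisymm him (neg_nonpos.1 h.1)))

theorem transferK_eq (x : ℝ) (z : ℂ) : transferK x z = kernelOfSqrt |x| (sqrtDivI z) := rfl

theorem differentiableOn_transferK (x : ℝ) : DifferentiableOn ℂ (transferK x) slitPlane :=
  fun z hz => ((differentiableAt_kernelOfSqrt |x| (ne_zero_of_sq_eq (sqrtDivI_sq z)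
    (slitPlane_ne_zero hz))).comp z (differentiableAt_sqrtDivI hz)).differentiableWithinAt

theorem norm_transferK_le (x : ℝ) {z : ℂ} {ξ : ℝ} (hz : -ξ ≤ z.re) :
    ‖transferK x z‖ ≤ Real.exp (|x| * Real.sqrt (ξ / 2)) / 2 * (Real.sqrt ‖z‖)⁻¹ :=
  norm_kernelOfSqrt_le (abs_nonneg x) (sqrtDivI_sq z) (sqrtDivI_im_le_re z) hz

/-- With $v=e^{i\pi/4}\sqrt l$, the square root takes the value $v$ on the upper side of the cut and
$-v$ on the lower side, and both forms of the jump equal $-\cosh(dv)/v$. -/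
theorem jumpG_eq (x : ℝ) {l : ℝ} (hl : 0 < l) :
    jumpG l x = kernelOfSqrt |x| (sqrtLower (-l)) - kernelOfSqrt |x| (sqrtUpper (-l)) := by
  set v : ℂ := Complex.exp (I * Real.pi / 4) * (Real.sqrt l : ℝ) with hv
  have hsl : ((Real.sqrt l : ℝ) : ℂ) ^ 2 = l := by
    rw [← ofReal_pow, Real.sq_sqrt hl.le]
  have he : Complex.exp (I * Real.pi / 4) ^ 2 = I := by
    rw [← Complex.exp_nat_mul]
    have : ((2 : ℕ) : ℂ) * (I * Real.pi / 4) = Real.pi / 2 * I := by push_cast; ring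
    rw [this, Complex.exp_pi_div_two_mul_I]
  have he' : Complex.exp (I * Real.pi / 4) =
      ((Real.sqrt 2 / 2 : ℝ) : ℂ) + ((Real.sqrt 2 / 2 : ℝ) : ℂ) * I := by
    have : (I * Real.pi / 4 : ℂ) = ((Real.pi / 4 : ℝ) : ℂ) * I := by push_cast; ring
    rw [this, exp_mul_I, ← ofReal_cos, ← ofReal_sin, Real.cos_pi_div_four, Real.sin_pi_div_four]
  have hs0 : 0 < Real.sqrt l := Real.sqrt_pos.2 hl
  have hs2 : 0 < Real.sqrt 2 := by positivity
  have hu : sqrtUpper (-l) = v := by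
    refine cpow_half_eq_of_sq_eq ?_ ?_
    · rw [hv, mul_pow, he, hsl]; ring
    · rw [hv, he', re_mul_ofReal]
      simp only [add_re, ofReal_re, re_ofReal_mul, I_re, mul_zero, add_zero]
      positivity
  have hlow : sqrtLower (-l) = -v := by
    have h1 : (I * (-l : ℂ)) ^ (1 / 2 : ℂ) = -I * v := by
      refine cpow_half_eq_of_sq_eq ?_ ?_
      · rw [hv, mul_pow, mul_pow, he, hsl, neg_sq, I_sq]; ring
      · rw [neg_mul, neg_re, I_mul_re, neg_neg, hv, he', im_mul_ofReal]
        simp only [add_im, ofReal_im, im_ofReal_mul, I_im, mul_one, zero_add]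
        positivity
    rw [sqrtLower, h1, ← mul_assoc, neg_mul_neg, I_mul_I]; ring
  have hv0 : v ≠ 0 := mul_ne_zero (Complex.exp_ne_zero _) (by exact_mod_cast hs0.ne')
  rw [hu, hlow, kernelOfSqrt, kernelOfSqrt, jumpG, Complex.cosh]
  have hE : Complex.exp (I * Real.pi / 4) ≠ 0 := Complex.exp_ne_zero _
  have hS : ((Real.sqrt l : ℝ) : ℂ) ≠ 0 := by exact_mod_cast hs0.ne'
  have h2 : ((|x| : ℝ) : ℂ) * Complex.exp (I * Real.pi / 4) * (Real.sqrt l : ℝ) = (|x| : ℝ) * v := by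
    rw [hv]; ring
  have h3 : I * Complex.exp (I * Real.pi / 4) / ((Real.sqrt l : ℝ) : ℂ) = -1 / v := by
    rw [hv]
    field_simp
    linear_combination I * he + I_sq
  rw [h2, h3, neg_mul_neg, neg_mul]
  field_simp
  ring

end Transfer

/-! ### Contour integrals for the weights and the shift across the cut. -/

namespace RungeKutta

variable {m : ℕ} {M : RungeKutta m}

/-- The decay estimate blows up at $0$, while $q$ is continuous there. The form $(1+|z|)^{-1}$
combines with the $|z|^{-1/2}$ of the kernel to give `decay`. -/
theorem Admissible.exists_norm_q_le (hM : M.Admissible) {h : ℝ} (hh : 0 < h) (j : Fin (m + 1)) :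
    ∃ C : ℝ, 0 ≤ C ∧ ∀ z : ℂ, z.re ≤ 0 → ‖M.q (h * z) j‖ ≤ C * (1 + ‖z‖)⁻¹ := by
  obtain ⟨C, hC, hb⟩ := hM.exists_isDecayConstant
    ((normSeminorm ℂ ℂ).comp (LinearMap.proj (R := ℂ) (φ := fun _ => ℂ) j))
  have hre : ∀ z : ℂ, z.re ≤ 0 → ((h : ℂ) * z).re ≤ 0 := fun z hz => by
    rw [re_ofReal_mul]; exact mul_nonpos_of_nonneg_of_nonpos hh.le hz
  have hK : IsCompact (Metric.closedBall (0 : ℂ) 1 ∩ {z : ℂ | z.re ≤ 0}) :=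
    (isCompact_closedBall _ _).inter_right (isClosed_le continuous_re continuous_const)
  obtain ⟨C', hC'⟩ := hK.exists_bound_of_continuousOn (f := fun z => M.q (h * z) j) fun z hz =>
    (ContinuousAt.comp (f := fun z : ℂ => (h : ℂ) * z) (g := fun w => M.q w j)
      (hM.differentiableAt_q (hre z hz.2) j).continuousAt (by fun_prop)).continuousWithinAt
  refine ⟨2 * |C'| + 2 * (C * h⁻¹), by positivity, fun z hz => ?_⟩
  have h0 : 0 ≤ ‖z‖ := norm_nonneg z
  rw [add_mul]
  rcases le_total ‖z‖ 1 with h1 | h1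
  · refine le_trans ?_ (le_add_of_nonneg_right (by positivity))
    refine (hC' z ⟨by simpa using h1, hz⟩).trans ((le_abs_self _).trans ?_)
    rw [← div_eq_mul_inv, le_div_iff₀ (by positivity)]
    nlinarith [abs_nonneg C']
  · refine le_trans ?_ (le_add_of_nonneg_left (by positivity))
    have hz0 : z ≠ 0 := norm_pos_iff.1 (by linarith)
    have h2 := (le_max_right _ _).trans
      (hb _ (hre z hz) (mul_ne_zero (by exact_mod_cast hh.ne') hz0))
    have h3 : ‖M.q (h * z) j‖ ≤ C * ‖(h : ℂ) * z‖⁻¹ := h2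
    rw [norm_mul, norm_real, Real.norm_of_nonneg hh.le, mul_inv] at h3
    have h4 : ‖z‖⁻¹ ≤ 2 * (1 + ‖z‖)⁻¹ := by
      rw [← div_eq_mul_inv, inv_eq_one_div, div_le_div_iff₀ (by linarith) (by positivity)]
      linarith
    calc _ ≤ _ := h3
      _ ≤ C * (h⁻¹ * (2 * (1 + ‖z‖)⁻¹)) := by gcongr
      _ = _ := by ring

variable (M) in
/-- The scalar factor `r(hz)ⁿ q(hz)_j` of the contour integrals for the weights. -/
def weightFactor (h : ℝ) (n : ℕ) (j : Fin (m + 1)) (z : ℂ) : ℂ := M.r (h * z) ^ n * M.q (h * z) j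

theorem Admissible.exists_norm_weightFactor_le (hM : M.Admissible) {h : ℝ} (hh : 0 < h)
    (j : Fin (m + 1)) : ∃ C : ℝ, 0 ≤ C ∧ ∀ n (z : ℂ), z.re ≤ 0 →
      ‖M.weightFactor h n j z‖ ≤ C * (1 + ‖z‖)⁻¹ := by
  obtain ⟨C, hC, hb⟩ := hM.exists_norm_q_le hh j
  refine ⟨C, hC, fun n z hz => ?_⟩
  rw [weightFactor, norm_mul, norm_pow]
  have h1 : ‖M.r (h * z)‖ ≤ 1 := hM.stable _ (by
    rw [re_ofReal_mul]; exact mul_nonpos_of_nonneg_of_nonpos hh.le hz)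
  exact (mul_le_of_le_one_left (norm_nonneg _) (pow_le_one₀ (norm_nonneg _) h1)).trans (hb z hz)

theorem Admissible.differentiableAt_weightFactor (hM : M.Admissible) {h : ℝ} (hh : 0 < h) (n : ℕ)
    (j : Fin (m + 1)) {z : ℂ} (hz : z.re ≤ 0) :
    DifferentiableAt ℂ (M.weightFactor h n j) z := by
  have hre : ((h : ℂ) * z).re ≤ 0 := by
    rw [re_ofReal_mul]; exact mul_nonpos_of_nonneg_of_nonpos hh.le hz
  have h1 : DifferentiableAt ℂ (fun z : ℂ => (h : ℂ) * z) z := by fun_prop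
  exact (((hM.differentiableAt_r hre).comp z h1).pow n).mul ((hM.differentiableAt_q hre j).comp z h1)

/-- The Cauchy formula is applied to $B=\Delta(\zeta)/h$, with $z-B=-h^{-1}(\Delta(\zeta)-hz)$; this
accounts for the factor $h$ and turns the sign $-2\pi$ into $+$. -/
theorem Admissible.weightMatrix_last_eq (hM : M.Admissible) {h : ℝ} (hh : 0 < h) (x : ℝ) {ζ : ℂ}
    (hζ : ‖ζ‖ < 1) (j : Fin (m + 1)) :
    matrixFunction (transferK x) ((h : ℂ)⁻¹ • M.symbol ζ) (Fin.last m) j =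
      (h / (2 * Real.pi) : ℝ) * ∫ y : ℝ, transferK x (y * I) *
        (M.q (h * (y * I)) j * (1 - ζ * M.r (h * (y * I)))⁻¹) := by
  have hh0 : (h : ℂ) ≠ 0 := by exact_mod_cast hh.ne'
  have hre : ∀ z : ℂ, z.re ≤ 0 → ((h : ℂ) * z).re ≤ 0 := fun z hz => by
    rw [re_ofReal_mul]; exact mul_nonpos_of_nonneg_of_nonpos hh.le hz
  have hB : ∀ z : ℂ, z • (1 : Matrix (Fin (m + 1)) (Fin (m + 1)) ℂ) - (h : ℂ)⁻¹ • M.symbol ζ =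
      (Units.mk0 (-(h : ℂ)⁻¹) (neg_ne_zero.2 (inv_ne_zero hh0))) •
        (M.symbol ζ - (h * z) • (1 : Matrix (Fin (m + 1)) (Fin (m + 1)) ℂ)) := by
    intro z
    simp only [Units.smul_def, Units.val_mk0, smul_sub, smul_smul]
    have : -(h : ℂ)⁻¹ * (h * z) = -z := by field_simp
    rw [this]; module
  have hu : ∀ z : ℂ, z.re ≤ 0 →
      IsUnit (z • (1 : Matrix (Fin (m + 1)) (Fin (m + 1)) ℂ) - (h : ℂ)⁻¹ • M.symbol ζ) := by
    intro z hz
    rw [hB, isUnit_smul_iff]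
    exact hM.isUnit_symbol_sub hζ (hre z hz)
  have hinv : ∀ z : ℂ, z.re ≤ 0 →
      (z • (1 : Matrix (Fin (m + 1)) (Fin (m + 1)) ℂ) - (h : ℂ)⁻¹ • M.symbol ζ)⁻¹ (Fin.last m) j =
        -h * (M.q (h * z) j * (1 - ζ * M.r (h * z))⁻¹) := by
    intro z hz
    rw [hB, Matrix.inv_smul' _ _
      ((Matrix.isUnit_iff_isUnit_det _).1 (hM.isUnit_symbol_sub hζ (hre z hz))), Units.smul_def,
      Matrix.smul_apply, hM.symbol_sub_inv_last hζ (hre z hz), smul_eq_mul]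
    simp
  have key := matrixFunction_apply_eq_integral (differentiableOn_transferK x)
    (fun z hz _ => norm_transferK_le x (ξ := 0) (by simpa using hz)) hu (Fin.last m) j
  have e : ∀ y : ℝ, transferK x (y * I) *
      ((y * I : ℂ) • (1 : Matrix (Fin (m + 1)) (Fin (m + 1)) ℂ) -
        (h : ℂ)⁻¹ • M.symbol ζ)⁻¹ (Fin.last m) j =
      -h * (transferK x (y * I) * (M.q (h * (y * I)) j * (1 - ζ * M.r (h * (y * I)))⁻¹)) := by
    intro y
    rw [hinv _ (by simp)]; ring
  simp only [e] at key
  rw [integral_const_mul] at key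
  have hpi : (Real.pi : ℂ) ≠ 0 := by exact_mod_cast Real.pi_ne_zero
  generalize (∫ y : ℝ, transferK x (y * I) *
        (M.q (h * (y * I)) j * (1 - ζ * M.r (h * (y * I)))⁻¹)) = J at key ⊢
  generalize matrixFunction (transferK x) ((h : ℂ)⁻¹ • M.symbol ζ) (Fin.last m) j = F at key ⊢
  push_cast
  field_simp
  linear_combination key

/-- Stating the bound for any root $w$ with $\Im w\le\Re w$ lets it cover the principal branch and
its continuations from both sides of the cut. -/
theorem Admissible.norm_transferK_mul_weightFactor_le (hM : M.Admissible) {h : ℝ} (hh : 0 < h)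
    (j : Fin (m + 1)) {d ξ : ℝ} (hd : 0 ≤ d) :
    ∃ C : ℝ, 0 ≤ C ∧ ∀ (n : ℕ) (w z : ℂ), w ^ 2 = -I * z → w.im ≤ w.re → -ξ ≤ z.re → z.re ≤ 0 →
      ‖kernelOfSqrt d w * M.weightFactor h n j z‖ ≤ C * decay ‖z‖ := by
  obtain ⟨C, hC, hb⟩ := hM.exists_norm_weightFactor_le hh j
  refine ⟨Real.exp (d * Real.sqrt (ξ / 2)) / 2 * C, by positivity, fun n w z hw hwi hz1 hz2 => ?_⟩
  rw [norm_mul]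
  calc _ ≤ (Real.exp (d * Real.sqrt (ξ / 2)) / 2 * (Real.sqrt ‖z‖)⁻¹) * (C * (1 + ‖z‖)⁻¹) :=
        mul_le_mul (norm_kernelOfSqrt_le hd hw hwi hz1) (hb n z hz2) (norm_nonneg _) (by positivity)
    _ = _ := by unfold decay; ring

theorem continuousOn_transferK_line (x : ℝ) {c : ℝ} :
    ContinuousOn (fun y : ℝ => transferK x (c + y * I)) {0}ᶜ := by
  refine (differentiableOn_transferK x).continuousOn.comp (by fun_prop) fun y hy => ?_
  rw [mem_slitPlane_iff]
  right
  simpa using hy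

theorem Admissible.integrable_line (hM : M.Admissible) {h : ℝ} (hh : 0 < h) (x : ℝ) (n : ℕ)
    (j : Fin (m + 1)) {c : ℝ} (hc : c ≤ 0) :
    Integrable fun y : ℝ => transferK x (c + y * I) * M.weightFactor h n j (c + y * I) := by
  obtain ⟨C, hC, hb⟩ := hM.norm_transferK_mul_weightFactor_le hh j (ξ := -c) (abs_nonneg x)
  refine integrable_of_norm_le_decay (C := C) ?_ fun y hy => ?_
  · refine (continuousOn_transferK_line x).mul fun y _ => ?_
    exact ContinuousAt.continuousWithinAt (ContinuousAt.comp (f := fun y : ℝ => (c : ℂ) + y * I)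
      (hM.differentiableAt_weightFactor hh n j (by simpa using hc)).continuousAt (by fun_prop))
  · refine (hb n _ _ (sqrtDivI_sq _) (sqrtDivI_im_le_re _) (by simp) (by simpa using hc)).trans
      (mul_le_mul_of_nonneg_left (decay_anti (abs_pos.2 hy) ?_) hC)
    refine le_trans ?_ (abs_im_le_norm _)
    simp

theorem Admissible.omega_apply (hM : M.Admissible) {h : ℝ} (hh : 0 < h) (x : ℝ) (n : ℕ)
    (j : Fin (m + 1)) :
    M.omega h x n j = (h / (2 * Real.pi) : ℝ) *
      ∫ y : ℝ, transferK x (y * I) * M.weightFactor h n j (y * I) := by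
  rw [omega, weightMatrix]
  refine powerCoeff_apply_of_hasSum (c := fun n => (h / (2 * Real.pi) : ℝ) *
      ∫ y : ℝ, transferK x (y * I) * M.weightFactor h n j (y * I)) (fun ζ hζ => ?_) n
  rw [hM.weightMatrix_last_eq hh x hζ j]
  simp only [mul_assoc]
  refine HasSum.mul_left _ ?_
  simp only [← integral_mul_const]
  have hline : ∀ n, Integrable fun y : ℝ => transferK x (y * I) * M.weightFactor h n j (y * I) :=
    fun n => by simpa using hM.integrable_line hh x n j (c := 0) le_rfl
  have hre : ∀ y : ℝ, ((h : ℂ) * (y * I)).re ≤ 0 := fun y => by simp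
  have hlt : ∀ y : ℝ, ‖ζ * M.r (h * (y * I))‖ < 1 := fun y => by
    rw [norm_mul]
    nlinarith [norm_nonneg ζ, norm_nonneg (M.r (h * (y * I))), hM.stable _ (hre y)]
  -- Since $|r|\le1$, the $n$-th term is dominated by $|\zeta|^n$ times the integrand for $n=0$,
  -- which permits exchanging the geometric series with the integral.
  refine hasSum_integral_of_dominated_convergence
    (fun n y => ‖transferK x (y * I) * M.weightFactor h 0 j (y * I)‖ * ‖ζ‖ ^ n)
    (fun n => ((hline n).mul_const _).aestronglyMeasurable)
    (fun n => Eventually.of_forall fun y => ?_)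
    (Eventually.of_forall fun y => (summable_geometric_of_lt_one (norm_nonneg _) hζ).mul_left _)
    ?_ (Eventually.of_forall fun y => ?_)
  · rw [norm_mul, norm_pow]
    gcongr ?_ * _
    rw [norm_mul, norm_mul]
    gcongr ?_ * ?_
    rw [weightFactor, weightFactor, norm_mul, norm_pow, pow_zero, one_mul]
    exact mul_le_of_le_one_left (norm_nonneg _)
      (pow_le_one₀ (norm_nonneg _) (hM.stable _ (hre y)))
  · simp only [tsum_mul_left]
    exact (hline 0).norm.mul_const _
  · have := (hasSum_geometric_of_norm_lt_one (hlt y)).mul_left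
      (transferK x (y * I) * M.q (h * (y * I)) j)
    rw [← mul_assoc]
    have e : (fun k => transferK x (y * I) * M.weightFactor h k j (y * I) * ζ ^ k) =
        fun k => transferK x (y * I) * M.q (h * (y * I)) j * (ζ * M.r (h * (y * I))) ^ k := by
      ext k
      rw [weightFactor, mul_pow]; ring
    rw [e]
    exact this

theorem integral_eq_integral_Ioi_add {g : ℝ → ℂ} (hg : Integrable g) :
    ∫ y, g y = (∫ y in Ioi (0 : ℝ), g y) + ∫ y in Ioi (0 : ℝ), g (-y) := by
  rw [integral_comp_neg_Ioi, neg_zero, add_comm]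
  exact (intervalIntegral.integral_Iic_add_Ioi hg.integrableOn hg.integrableOn).symm

/-- Shifting the contour for the weights to the left, across the cut `(-ξ, 0)`. -/
theorem Admissible.integral_shift (hM : M.Admissible) {h : ℝ} (hh : 0 < h) (x : ℝ) (n : ℕ)
    (j : Fin (m + 1)) {ξ : ℝ} (hξ : 0 < ξ) :
    IntervalIntegrable (fun l : ℝ => jumpG l x * M.weightFactor h n j (-(l : ℂ))) volume 0 ξ ∧
    ∫ l in (0 : ℝ)..ξ, jumpG l x * M.weightFactor h n j (-(l : ℂ)) =
      I * ((∫ y : ℝ, transferK x (y * I) * M.weightFactor h n j (y * I)) -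
      ∫ y : ℝ, transferK x ((-ξ : ℝ) + y * I) * M.weightFactor h n j ((-ξ : ℝ) + y * I)) := by
  obtain ⟨C, hC, hb⟩ := hM.norm_transferK_mul_weightFactor_le hh j (ξ := ξ) (abs_nonneg x)
  set W := M.weightFactor h n j with hW
  have hWd : ∀ z : ℂ, z.re ≤ 0 → DifferentiableAt ℂ W z := fun z hz =>
    hM.differentiableAt_weightFactor hh n j hz
  -- The integrand is continued from each side of the cut, so that on each closed half-strip only
  -- the singularity at $0$ remains.
  set fU : ℂ → ℂ := fun z => kernelOfSqrt |x| (sqrtUpper z) * W z with hfU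
  set fL : ℂ → ℂ := fun z => kernelOfSqrt |x| (sqrtLower z) * W z with hfL
  have hUd : ∀ z : ℂ, z ≠ 0 → 0 ≤ z.im → z.re ≤ 0 → DifferentiableAt ℂ fU z := fun z hz h1 h2 =>
    ((differentiableAt_kernelOfSqrt |x| (ne_zero_of_sq_eq (sqrtUpper_sq z) hz)).comp z
      (differentiableAt_sqrtUpper hz h1)).mul (hWd z h2)
  have hLd : ∀ z : ℂ, z ≠ 0 → z.im ≤ 0 → z.re ≤ 0 → DifferentiableAt ℂ fL z := fun z hz h1 h2 =>
    ((differentiableAt_kernelOfSqrt |x| (ne_zero_of_sq_eq (sqrtLower_sq z) hz)).comp z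
      (differentiableAt_sqrtLower hz h1)).mul (hWd z h2)
  have hUb : ∀ z : ℂ, -ξ ≤ z.re → z.re ≤ 0 → 0 ≤ z.im → z ≠ 0 → ‖fU z‖ ≤ C * decay ‖z‖ := by
    intro z h1 h2 h3 h4
    refine hb n _ z (sqrtUpper_sq z) ?_ h1 h2
    rw [← sqrtDivI_eq_sqrtUpper h4 h3]
    exact sqrtDivI_im_le_re z
  have hLb : ∀ z : ℂ, -ξ ≤ z.re → z.re ≤ 0 → z.im ≤ 0 → z ≠ 0 → ‖fL z‖ ≤ C * decay ‖z‖ :=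
    fun z h1 h2 h3 _ => hb n _ z (sqrtLower_sq z) (sqrtLower_im_le_re h3) h1 h2
  have hU := integral_boundary_halfStrip_eq_zero (f := fU) (a := -ξ) (b := 0) (by linarith) hC
    (fun z hz => (hUd z hz.2 hz.1.2.2 hz.1.2.1).continuousAt.continuousWithinAt)
    (fun z hz => (hUd z (by rintro rfl; simpa using hz.2.2) hz.2.2.le
      hz.2.1.le).differentiableWithinAt) hUb
  have hLd' : ∀ z : ℂ, z ≠ 0 → 0 ≤ z.im → 0 ≤ z.re → DifferentiableAt ℂ (fun w => fL (-w)) z :=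
    fun z h1 h2 h3 => (hLd (-z) (neg_ne_zero.2 h1) (by simpa using h2) (by simpa using h3)).comp z
      differentiableAt_id.neg
  -- The lower half-strip becomes an upper one under $z\mapsto-z$, which also interchanges its
  -- vertical sides.
  have hL := integral_boundary_halfStrip_eq_zero (f := fun w => fL (-w)) (a := 0) (b := ξ) hξ.le hC
    (fun z hz => (hLd' z hz.2 hz.1.2.2 hz.1.1).continuousAt.continuousWithinAt)
    (fun z hz => (hLd' z (by rintro rfl; simpa using hz.2.2) hz.2.2.le
      hz.1.le).differentiableWithinAt)
    (fun z h1 h2 h3 h4 => by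
      rw [← norm_neg z]
      exact hLb (-z) (by simpa using h2) (by simpa using h1) (by simpa using h3)
        (neg_ne_zero.2 h4))
  have hfUeq : ∀ z : ℂ, 0 < z.im → fU z = transferK x z * W z := fun z hz => by
    rw [transferK_eq, sqrtDivI_eq_sqrtUpper (by rintro rfl; simp at hz) hz.le]
  have hfLeq : ∀ z : ℂ, z.im < 0 → fL z = transferK x z * W z := fun z hz => by
    rw [transferK_eq, sqrtDivI_eq_sqrtLower hz]
  have eU : ∀ c : ℝ, ∫ y in Ioi (0 : ℝ), fU (c + y * I) =
      ∫ y in Ioi (0 : ℝ), transferK x (c + y * I) * W (c + y * I) := fun c =>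
    setIntegral_congr_fun measurableSet_Ioi fun y hy => hfUeq _ (by simpa using hy)
  have eL : ∀ c : ℝ, ∫ y in Ioi (0 : ℝ), fL (-(c + y * I)) =
      ∫ y in Ioi (0 : ℝ), transferK x ((-c : ℝ) + ((-y : ℝ) : ℂ) * I) *
        W ((-c : ℝ) + ((-y : ℝ) : ℂ) * I) := fun c =>
    setIntegral_congr_fun measurableSet_Ioi fun y hy => by
      have : (-(c + y * I) : ℂ) = (-c : ℝ) + ((-y : ℝ) : ℂ) * I := by push_cast; ring
      simp only [this]
      exact hfLeq _ (by simpa using hy)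
  have hgen : ∀ g : ℂ → ℂ, (∀ l : ℝ, 0 < l → ContinuousAt g (-(l : ℂ))) →
      (∀ l : ℝ, 0 < l → l ≤ ξ → ‖g (-(l : ℂ))‖ ≤ C * decay l) →
      IntervalIntegrable (fun l : ℝ => g (-(l : ℂ))) volume 0 ξ := by
    intro g hgc hgb
    rw [intervalIntegrable_iff_integrableOn_Ioc_of_le hξ.le]
    have hd : IntegrableOn (fun l => C * decay l) (Ioc 0 ξ) :=
      (integrableOn_decay.mono_set Ioc_subset_Ioi_self).const_mul C
    refine hd.mono' (ContinuousOn.aestronglyMeasurable (fun l hl => ?_) measurableSet_Ioc) ?_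
    · exact (ContinuousAt.comp (f := fun l : ℝ => -(l : ℂ)) (hgc l hl.1)
        (by fun_prop)).continuousWithinAt
    · filter_upwards [ae_restrict_mem measurableSet_Ioc] with l hl using hgb l hl.1 hl.2
  have hl0 : ∀ l : ℝ, 0 < l → -(l : ℂ) ≠ 0 := fun l hl =>
    neg_ne_zero.2 (by exact_mod_cast hl.ne')
  have hUi := hgen fU (fun l hl => (hUd _ (hl0 l hl) (by simp) (by simpa using hl.le)).continuousAt)
    (fun l hl hlξ => by
      simpa [abs_of_pos hl] using hUb (-(l : ℂ)) (by simpa using hlξ) (by simpa using hl.le)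
        (by simp) (hl0 l hl))
  have hLi := hgen fL (fun l hl => (hLd _ (hl0 l hl) (by simp) (by simpa using hl.le)).continuousAt)
    (fun l hl hlξ => by
      simpa [abs_of_pos hl] using hLb (-(l : ℂ)) (by simpa using hlξ) (by simpa using hl.le)
        (by simp) (hl0 l hl))
  have hjump : ∀ l : ℝ, 0 < l → fL (-(l : ℂ)) - fU (-(l : ℂ)) = jumpG l x * W (-(l : ℂ)) := by
    intro l hl
    rw [jumpG_eq x hl, hfL, hfU]
    simp only
    ring
  have hUneg : ∫ t in (-ξ)..0, fU t = ∫ l in (0 : ℝ)..ξ, fU (-(l : ℂ)) := by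
    have := intervalIntegral.integral_comp_neg (a := 0) (b := ξ) (fun t : ℝ => fU t)
    rw [neg_zero] at this
    rw [← this]
    simp
  constructor
  · refine (hLi.sub hUi).congr fun l hl => ?_
    rw [uIoc_of_le hξ.le] at hl
    exact hjump l hl.1
  · have h1 : ∫ l in (0 : ℝ)..ξ, jumpG l x * W (-(l : ℂ)) =
        (∫ l in (0 : ℝ)..ξ, fL (-(l : ℂ))) - ∫ l in (0 : ℝ)..ξ, fU (-(l : ℂ)) := by
      rw [← intervalIntegral.integral_sub hLi hUi]
      refine intervalIntegral.integral_congr_ae (Eventually.of_forall fun l hl => ?_)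
      rw [uIoc_of_le hξ.le] at hl
      exact (hjump l hl.1).symm
    have i0 := integral_eq_integral_Ioi_add (hM.integrable_line hh x n j (c := 0) le_rfl)
    have i1 := integral_eq_integral_Ioi_add (hM.integrable_line hh x n j (c := -ξ) (by linarith))
    rw [hUneg, eU, eU] at hU
    simp only [eL] at hL
    rw [← hW] at i0 i1
    simp only [neg_zero] at hL
    have i0' : ∫ y : ℝ, transferK x (y * I) * W (y * I) =
        ∫ y : ℝ, transferK x (((0 : ℝ) : ℂ) + y * I) * W (((0 : ℝ) : ℂ) + y * I) := by simp
    rw [h1, i0', i0, i1]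
    -- The vertical half-lines join to the two full lines, and the horizontal sides combine into the
    -- jump.
    linear_combination hL - hU

theorem Admissible.omega_sub_truncatedIntegral_apply (hM : M.Admissible) {h : ℝ} (hh : 0 < h)
    (x : ℝ) (n : ℕ) (j : Fin (m + 1)) {ξ : ℝ} (hξ : 0 < ξ) :
    (M.omega h x n - M.truncatedIntegral h x ξ n) j = (h / (2 * Real.pi) : ℝ) *
      ∫ y : ℝ, transferK x ((-ξ : ℝ) + y * I) * M.weightFactor h n j ((-ξ : ℝ) + y * I) := by
  have heq : ∀ (j : Fin (m + 1)) (l : ℝ), l ∈ uIoc 0 ξ →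
      jumpG l x * M.weightFactor h n j (-(l : ℂ)) =
      (jumpG l x • M.e n (-((h * l : ℝ) : ℂ))) j := by
    intro j l hl
    rw [uIoc_of_le hξ.le] at hl
    have h1 : (-((h * l : ℝ) : ℂ)).re ≤ 0 := by
      rw [neg_re, ofReal_re]
      nlinarith [hl.1]
    rw [Pi.smul_apply, hM.e_eq n h1, weightFactor, smul_eq_mul]
    push_cast
    rw [mul_neg]
  have hint : ∀ j, IntervalIntegrable (fun l : ℝ => (jumpG l x • M.e n (-((h * l : ℝ) : ℂ))) j)
      volume 0 ξ := fun j =>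
    (hM.integral_shift hh x n j hξ).1.congr fun l hl => heq j l hl
  have htr : M.truncatedIntegral h x ξ n j = ((h : ℂ) / (2 * Real.pi * I)) *
      ∫ l in (0 : ℝ)..ξ, jumpG l x * M.weightFactor h n j (-(l : ℂ)) := by
    rw [truncatedIntegral, Pi.smul_apply, smul_eq_mul]
    congr 1
    rw [intervalIntegral.integral_congr_ae (Eventually.of_forall fun l hl => heq j l hl)]
    rw [intervalIntegral.integral_of_le hξ.le, intervalIntegral.integral_of_le hξ.le]
    -- The integral of a vector function is evaluated coordinatewise, which requires every
    -- coordinate to be integrable.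
    refine eval_integral (fun j => ?_) j
    exact (hint j).1
  rw [Pi.sub_apply, htr, (hM.integral_shift hh x n j hξ).2, hM.omega_apply hh]
  have hpi : (Real.pi : ℂ) ≠ 0 := by exact_mod_cast Real.pi_ne_zero
  generalize (∫ y : ℝ, transferK x (y * I) * M.weightFactor h n j (y * I)) = J₁
  generalize (∫ y : ℝ, transferK x ((-ξ : ℝ) + y * I) *
    M.weightFactor h n j ((-ξ : ℝ) + y * I)) = J₂
  push_cast
  field_simp [I_ne_zero]
  ring

end RungeKutta

/-! ### Integrals under a seminorm, and the constant with $\Gamma(3/4)$. -/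

/-- Hahn–Banach extension of $cv\mapsto cN(v)$ from the line spanned by $v$. -/
theorem exists_dual_eq_seminorm {E : Type*} [AddCommGroup E] [Module ℂ E] (N : Seminorm ℂ E)
    (v : E) : ∃ φ : Module.Dual ℂ E, φ v = (N v : ℂ) ∧ ∀ x, ‖φ x‖ ≤ N x := by
  by_cases hv : v = 0
  · exact ⟨0, by simp [hv], fun x => by simp⟩
  set f : E →ₗ.[ℂ] ℂ := LinearPMap.mkSpanSingleton v (N v : ℂ) hv
  have happ : ∀ (c : ℂ) (hc : c • v ∈ f.domain), f ⟨c • v, hc⟩ = c • (N v : ℂ) := fun c hc =>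
    LinearPMap.mkSpanSingleton'_apply v (N v : ℂ) _ c hc
  obtain ⟨φ, h1, h2⟩ := Module.Dual.exists_extension_of_le_seminorm f.domain f.toFun (p := N) (by
    rintro ⟨x, hx⟩
    obtain ⟨c, rfl⟩ := Submodule.mem_span_singleton.1 hx
    change ‖f ⟨c • v, hx⟩‖ ≤ N (c • v)
    rw [happ, map_smul_eq_mul, smul_eq_mul, norm_mul, norm_real,
      Real.norm_of_nonneg (apply_nonneg N v)])
  refine ⟨φ, ?_, h2⟩
  have hv1 : (1 : ℂ) • v ∈ f.domain := by
    rw [one_smul]; exact Submodule.mem_span_singleton_self v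
  have h3 := (h1 ⟨_, hv1⟩).trans (happ 1 hv1)
  simpa using h3

/-- Testing with a functional that norms the integral reduces the claim to the scalar case. No
equivalence-of-norms constant enters, so $C_A$ survives unchanged. -/
theorem seminorm_integral_le {ι : Type*} [Fintype ι] [DecidableEq ι] (N : Seminorm ℂ (ι → ℂ))
    {f : ℝ → ι → ℂ} (hf : ∀ i, Integrable fun y => f y i) {g : ℝ → ℝ} (hg : Integrable g)
    (hfg : ∀ y, N (f y) ≤ g y) : N (fun i => ∫ y, f y i) ≤ ∫ y, g y := by
  obtain ⟨φ, h1, h2⟩ := exists_dual_eq_seminorm N fun i => ∫ y, f y i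
  have hφ : ∀ v : ι → ℂ, φ v = ∑ i, v i * φ (Pi.single i 1) := by
    intro v
    have hv : v = ∑ i, v i • (Pi.single i 1 : ι → ℂ) := by
      ext k; simp [Finset.sum_apply, Pi.single_apply]
    conv_lhs => rw [hv]
    simp
  have h3 : φ (fun i => ∫ y, f y i) = ∫ y, φ (f y) := by
    rw [hφ]
    simp only [hφ (f _)]
    rw [integral_finsetSum _ fun i _ => (hf i).mul_const _]
    simp only [integral_mul_const]
  have h4 : N (fun i => ∫ y, f y i) = ‖∫ y, φ (f y)‖ := by
    rw [← h3, h1, norm_real, Real.norm_of_nonneg (apply_nonneg N _)]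
  rw [h4]
  exact norm_integral_le_of_norm_le hg (Eventually.of_forall fun y => (h2 _).trans (hfg y))

/-- Write $\Gamma(s)(1+y^2)^{-s}=\int_0^\infty t^{s-1}e^{-(1+y^2)t}\,dt$ and exchange the integrals:
the Gaussian in $y$ gives $\sqrt{\pi/t}$, and what remains is $\Gamma(s-\frac12)$. -/
theorem integral_one_add_sq_rpow_neg {s : ℝ} (hs : 1 / 2 < s) :
    Integrable (fun y : ℝ => (1 + y ^ 2) ^ (-s)) ∧
    ∫ y : ℝ, (1 + y ^ 2) ^ (-s) = Real.sqrt Real.pi * Real.Gamma (s - 1 / 2) / Real.Gamma s := by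
  have hs0 : 0 < s := by linarith
  have hG := Real.Gamma_pos_of_pos hs0
  set F : ℝ × ℝ → ℝ := fun p => p.2 ^ (s - 1) * Real.exp (-((1 + p.1 ^ 2) * p.2)) with hF
  have hFm : Measurable F := by fun_prop
  have hinner : ∀ t : ℝ, 0 < t → ∀ y : ℝ,
      F (y, t) = t ^ (s - 1) * Real.exp (-t) * Real.exp (-t * y ^ 2) := by
    intro t _ y
    rw [hF, mul_assoc, ← Real.exp_add]
    simp only
    congr 2
    ring
  have hgint : ∀ t : ℝ, 0 < t →
      ∫ y : ℝ, F (y, t) = Real.sqrt Real.pi * (Real.exp (-t) * t ^ (s - 1 / 2 - 1)) := by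
    intro t ht
    simp only [hinner t ht]
    rw [integral_const_mul, integral_gaussian, Real.sqrt_div Real.pi_nonneg, Real.sqrt_eq_rpow t]
    have : t ^ (s - 1) / t ^ (1 / 2 : ℝ) = t ^ (s - 1 / 2 - 1) := by
      rw [← Real.rpow_sub ht]; congr 1; ring
    rw [← this]; ring
  have hint : Integrable F (volume.prod (volume.restrict (Ioi 0))) := by
    rw [integrable_prod_iff' hFm.aestronglyMeasurable]
    constructor
    · filter_upwards [ae_restrict_mem measurableSet_Ioi] with t ht
      have ht' : (0 : ℝ) < t := ht
      simp only [hinner t ht']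
      exact (integrable_exp_neg_mul_sq ht').const_mul _
    · have h1 : IntegrableOn (fun t : ℝ => Real.sqrt Real.pi * (Real.exp (-t) * t ^ (s - 1 / 2 - 1)))
          (Ioi 0) := (Real.GammaIntegral_convergent (by linarith)).const_mul _
      refine h1.congr_fun (fun t ht => ?_) measurableSet_Ioi
      have ht' : (0 : ℝ) < t := ht
      simp only
      rw [← hgint t ht']
      refine integral_congr_ae (Eventually.of_forall fun y => ?_)
      simp only [hF]
      rw [Real.norm_of_nonneg (by positivity)]
  have hout : ∀ y : ℝ, ∫ t in Ioi 0, F (y, t) = (1 + y ^ 2) ^ (-s) * Real.Gamma s := by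
    intro y
    have hp : 0 < 1 + y ^ 2 := by positivity
    rw [hF]
    simp only
    rw [Real.integral_rpow_mul_exp_neg_mul_Ioi hs0 hp, one_div, Real.inv_rpow hp.le,
      ← Real.rpow_neg hp.le]
  have hswap := integral_integral_swap (f := fun y t => F (y, t)) hint
  simp only [hout] at hswap
  have h2 : ∫ t in Ioi 0, ∫ y, F (y, t) = Real.sqrt Real.pi * Real.Gamma (s - 1 / 2) := by
    rw [setIntegral_congr_fun measurableSet_Ioi fun t ht => hgint t ht, integral_const_mul,
      Real.Gamma_eq_integral (by linarith)]
  constructor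
  · have h1 := hint.integral_prod_left
    simp only [hout] at h1
    simpa [hG.ne'] using h1.mul_const (Real.Gamma s)⁻¹
  · rw [eq_div_iff hG.ne', ← integral_mul_const, hswap, h2]

theorem integral_sq_add_sq_rpow {ξ : ℝ} (hξ : 0 < ξ) :
    Integrable (fun y : ℝ => (ξ ^ 2 + y ^ 2) ^ (-(3 / 4) : ℝ)) ∧
    ∫ y : ℝ, (ξ ^ 2 + y ^ 2) ^ (-(3 / 4) : ℝ) =
      (Real.sqrt ξ)⁻¹ * (Real.pi * Real.sqrt (2 * Real.pi) / Real.Gamma (3 / 4) ^ 2) := by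
  obtain ⟨h1, h2⟩ := integral_one_add_sq_rpow_neg (s := 3 / 4) (by norm_num)
  have hG := Real.Gamma_pos_of_pos (s := 3 / 4) (by norm_num)
  -- The integral at $s=3/4$ is $\sqrt\pi\,\Gamma(1/4)/\Gamma(3/4)$; the reflection formula replaces
  -- $\Gamma(1/4)$ by $\pi\sqrt2/\Gamma(3/4)$.
  have hrefl := Real.Gamma_mul_Gamma_one_sub (1 / 4)
  have e1 : (1 : ℝ) - 1 / 4 = 3 / 4 := by norm_num
  have e2 : Real.pi * (1 / 4) = Real.pi / 4 := by ring
  rw [e1, e2, Real.sin_pi_div_four] at hrefl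
  have e3 : (3 / 4 : ℝ) - 1 / 2 = 1 / 4 := by norm_num
  rw [e3] at h2
  have hscale : ∀ y : ℝ, (ξ ^ 2 + y ^ 2) ^ (-(3 / 4) : ℝ) =
      ξ ^ (-(3 / 2) : ℝ) * (1 + (y / ξ) ^ 2) ^ (-(3 / 4) : ℝ) := by
    intro y
    have : ξ ^ 2 + y ^ 2 = ξ ^ 2 * (1 + (y / ξ) ^ 2) := by field_simp
    rw [this, Real.mul_rpow (by positivity) (by positivity), ← Real.rpow_natCast ξ 2,
      ← Real.rpow_mul hξ.le]
    norm_num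
  simp only [hscale]
  constructor
  · exact (h1.comp_div hξ.ne').const_mul _
  · rw [integral_const_mul, Measure.integral_comp_div (fun y : ℝ => (1 + y ^ 2) ^ (-(3 / 4) : ℝ)),
      h2, abs_of_pos hξ, smul_eq_mul]
    have hs : ξ ^ (-(3 / 2) : ℝ) * ξ = (Real.sqrt ξ)⁻¹ := by
      rw [Real.sqrt_eq_rpow, ← Real.rpow_neg hξ.le]
      nth_rw 2 [← Real.rpow_one ξ]
      rw [← Real.rpow_add hξ]
      norm_num
    have hs2 : 0 < Real.sqrt 2 := by positivity
    have h22 : Real.sqrt 2 * Real.sqrt 2 = 2 := Real.mul_self_sqrt (by norm_num)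
    have hg : Real.Gamma (1 / 4) = Real.pi * Real.sqrt 2 / Real.Gamma (3 / 4) := by
      rw [eq_div_iff hG.ne', hrefl, div_eq_iff (by positivity)]
      linear_combination (-Real.pi / 2) * h22
    rw [← mul_assoc, hs, hg, Real.sqrt_mul (by norm_num)]
    field_simp

/-! ### The error bound and the choice of $n$. -/

namespace RungeKutta

variable {m : ℕ} {M : RungeKutta m}

theorem Admissible.seminorm_omega_sub_le (hM : M.Admissible) (N : Seminorm ℂ (Fin (m + 1) → ℂ))
    {h : ℝ} (hh : 0 < h) (x : ℝ) {ξ : ℝ} (hξ : 0 < ξ) {C : ℝ} (hC : M.IsDecayConstant N C) (n : ℕ) :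
    N (M.omega h x n - M.truncatedIntegral h x ξ n) ≤
      C * Real.sqrt (2 * Real.pi) / (4 * Real.sqrt ξ * Real.Gamma (3 / 4) ^ 2) *
        Real.exp (|x| * Real.sqrt (ξ / 2) - n * (h * ξ * M.gamma (h * ξ))) := by
  obtain ⟨hC0, hCb⟩ := hC
  obtain ⟨hi, hval⟩ := integral_sq_add_sq_rpow hξ
  have hG := Real.Gamma_pos_of_pos (s := 3 / 4) (by norm_num)
  -- The bounds of the kernel, of $r^n$ and of $q$ on $\Re z=-\xi$, without their common factor
  -- $|z|^{-1/2}|z|^{-1}=(\xi^2+y^2)^{-3/4}$.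
  set K := Real.exp (|x| * Real.sqrt (ξ / 2)) / 2 *
    (Real.exp (-(h * ξ * M.gamma (h * ξ))) ^ n * (C * h⁻¹)) with hK
  have hv : M.omega h x n - M.truncatedIntegral h x ξ n = ((h / (2 * Real.pi) : ℝ) : ℂ) •
      fun j => ∫ y : ℝ, (transferK x ((-ξ : ℝ) + y * I) *
        M.r (h * ((-ξ : ℝ) + y * I)) ^ n) * M.q (h * ((-ξ : ℝ) + y * I)) j := by
    ext j
    rw [hM.omega_sub_truncatedIntegral_apply hh x n j hξ, Pi.smul_apply, smul_eq_mul]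
    simp only [weightFactor, mul_assoc]
  have hbound : ∀ y : ℝ, N (fun j => (transferK x ((-ξ : ℝ) + y * I) *
        M.r (h * ((-ξ : ℝ) + y * I)) ^ n) * M.q (h * ((-ξ : ℝ) + y * I)) j) ≤
      K * (ξ ^ 2 + y ^ 2) ^ (-(3 / 4) : ℝ) := by
    intro y
    set z : ℂ := ((-ξ : ℝ) : ℂ) + y * I with hz
    have hzre : z.re = -ξ := by simp [hz]
    have hhz : ((h : ℂ) * z).re = -(h * ξ) := by rw [re_ofReal_mul, hzre]; ring
    have hz0 : z ≠ 0 := by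
      rintro h0
      rw [h0] at hzre; simp at hzre; linarith
    have hzp := norm_pos_iff.2 hz0
    have h1 : N (fun j => (transferK x z * M.r (h * z) ^ n) * M.q (h * z) j) =
        ‖transferK x z‖ * (‖M.r (h * z)‖ ^ n * N (M.q (h * z))) := by
      have : (fun j => (transferK x z * M.r (h * z) ^ n) * M.q (h * z) j) =
          (transferK x z * M.r (h * z) ^ n) • M.q (h * z) := rfl
      rw [this, map_smul_eq_mul, norm_mul, norm_pow, mul_assoc]
    have h2 := norm_transferK_le x (z := z) (ξ := ξ) hzre.ge
    have h3 := hM.norm_r_le_exp (mul_pos hh hξ) hhz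
    have h4 : N (M.q (h * z)) ≤ C * (h⁻¹ * ‖z‖⁻¹) := by
      have := (le_max_right _ _).trans (hCb (h * z)
        (by rw [hhz]; exact neg_nonpos.2 (by positivity))
        (mul_ne_zero (by exact_mod_cast hh.ne') hz0))
      rwa [norm_mul, norm_real, Real.norm_of_nonneg hh.le, mul_inv] at this
    have h5 : (ξ ^ 2 + y ^ 2) ^ (-(3 / 4) : ℝ) = (Real.sqrt ‖z‖)⁻¹ * ‖z‖⁻¹ := by
      have : ξ ^ 2 + y ^ 2 = ‖z‖ ^ 2 := by
        rw [Complex.sq_norm, normSq_apply]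
        simp [hz]; ring
      rw [this, ← Real.rpow_natCast, ← Real.rpow_mul hzp.le, Real.sqrt_eq_rpow,
        ← Real.rpow_neg hzp.le, ← Real.rpow_neg_one ‖z‖, ← Real.rpow_add hzp]
      norm_num
    rw [h1, h5, hK]
    have hNn : 0 ≤ N (M.q (h * z)) := apply_nonneg N _
    calc _ ≤ (Real.exp (|x| * Real.sqrt (ξ / 2)) / 2 * (Real.sqrt ‖z‖)⁻¹) *
          (Real.exp (-(h * ξ * M.gamma (h * ξ))) ^ n * (C * (h⁻¹ * ‖z‖⁻¹))) := by gcongr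
      _ = _ := by ring
  have hint : ∀ j, Integrable fun y : ℝ => (transferK x ((-ξ : ℝ) + y * I) *
        M.r (h * ((-ξ : ℝ) + y * I)) ^ n) * M.q (h * ((-ξ : ℝ) + y * I)) j := fun j => by
    have := hM.integrable_line hh x n j (c := -ξ) (by linarith)
    simpa only [weightFactor, mul_assoc] using this
  have key := seminorm_integral_le N hint (hi.const_mul K) hbound
  rw [hv, map_smul_eq_mul, norm_real, Real.norm_of_nonneg (by positivity)]
  refine (mul_le_mul_of_nonneg_left key (by positivity)).trans (le_of_eq ?_)
  rw [integral_const_mul, hval, hK, sub_eq_add_neg, Real.exp_add, ← Real.exp_nat_mul,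
    mul_neg]
  have hpi := Real.pi_pos
  have hsξ := Real.sqrt_pos.2 hξ
  field_simp
  ring

end RungeKutta

end RKCQ

end

theorem corollary4p2 {m : ℕ} (M : RKCQ.RungeKutta m) (hM : M.Admissible)
    (N : Seminorm ℂ (Fin (m + 1) → ℂ)) (h : ℝ) (hh : 0 < h) (x : ℝ) (ξ : ℝ) (hξ : 1 < ξ) :
    0 < M.gamma (h * ξ) ∧
    (∃ C : ℝ, M.IsDecayConstant N C) ∧
    ∀ C : ℝ, M.IsDecayConstant N C → ∀ ε : ℝ, 0 < ε → ∀ n : ℕ,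
      (n : ℝ) ≥ 1 / (h * ξ * M.gamma (h * ξ)) *
        (|x| * Real.sqrt (ξ / 2) +
          Real.log (C * Real.sqrt (2 * Real.pi) /
            (4 * Real.sqrt ξ * Real.Gamma (3 / 4) ^ 2 * ε))) →
      N (M.omega h x n - M.truncatedIntegral h x ξ n) ≤ ε := by
  have hξ0 : 0 < ξ := by linarith
  have hγ := hM.gamma_pos (mul_pos hh hξ0)
  refine ⟨hγ, hM.exists_isDecayConstant N, fun C hC ε hε n hn => ?_⟩
  refine (hM.seminorm_omega_sub_le N hh x hξ0 hC n).trans ?_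
  have hC0 := hC.1
  have hG := Real.Gamma_pos_of_pos (s := 3 / 4) (by norm_num)
  have hsξ := Real.sqrt_pos.2 hξ0
  have hpi := Real.pi_pos
  have hD : 0 < h * ξ * M.gamma (h * ξ) := by positivity
  set K := C * Real.sqrt (2 * Real.pi) / (4 * Real.sqrt ξ * Real.Gamma (3 / 4) ^ 2) with hK
  have hK0 : 0 < K := by positivity
  rw [← div_div (C * _), ← hK, ge_iff_le, one_div, inv_mul_le_iff₀ hD] at hn
  -- The condition on $n$, multiplied by $h\xi\gamma(h\xi)>0$, says exactly that the exponent in the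
  -- error bound is at most $-\log(K/\varepsilon)$.
  have h1 : |x| * Real.sqrt (ξ / 2) - n * (h * ξ * M.gamma (h * ξ)) ≤ -Real.log (K / ε) := by
    linarith
  calc K * Real.exp (|x| * Real.sqrt (ξ / 2) - n * (h * ξ * M.gamma (h * ξ)))
      ≤ K * Real.exp (-Real.log (K / ε)) := by gcongr
    _ = ε := by
      rw [Real.exp_neg, Real.exp_log (by positivity)]
      field_simp
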